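/- Let $T$ be a simplicial tree with distinguished vertex $v_0$ and graph distance $d$, and let $l(g)=\min_w d(w,gw)$, over all points $w$ of the geometric realisation of $T$, be the translation length of $g\in\mathrm{Aut}(T)$. A subgroup of $\mathrm{Aut}(T)$ is \emph{purely hyperbolic} if $l(g)>0$ for each of its non-trivial elements $g$. For each $i\ge 0$ let $<_i$ be a well-ordering on the set of paths (without backtracking) of length $i$ that start at $v_0$, such that $p<_i q$ whenever, for some $j<i$, the initial subpath of $p$ of length $j$ is $<_j$ that of $q$. Order all paths starting at $v_0$ by $p<q$ if $p$ is shorter than $q$, or both have the same length $i$ and $p<_i q$. Order unordered pairs (repetition allowed) of such paths by $\{p,p'\}\prec\{q,q'\}$ if $\min(p,p')<\min(q,q')$, or $\min(p,p')=\min(q,q')$ and $\max(p,p')<\max(q,q')$. Put $|g|=d(v_0,gv_0)$, let $H(g)$ be the initial subpath of length $\lfloor |g|/2\rfloor$ of the path $[v_0,gv_0]$, and write $g<^\star h$ if $|g|<|h|$, or $|g|=|h|$ and $\{H(g),H(g^{-1})\}\prec\{H(h),H(h^{-1})\}$. For $S\subseteq\mathrm{Aut}(T)$ let $S^-=\{g^{-1}: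 g\in S\}$ and $S^\pm=S\cup S^-$. A free basis $S$ of a subgroup $G\le\mathrm{Aut}(T)$ is \emph{strongly N-reduced} if $S\cap S^-=\varnothing$ and $x<^\star xy$ for all $x,y\in S^\pm$ with $x\ne y^{-1}$. There is an algorithm which, given finite sets $X,Y\subseteq\mathrm{Aut}(T)$ (as lists) that generate purely hyperbolic groups $G=\langle X\rangle$ and $H=\langle Y\rangle$, decides whether $G=H$. More precisely, it halts on every such input and outputs strongly N-reduced free bases $X'$ of $G$ and $Y'$ of $H$, together with an answer which is ``yes'' if and only if $X'^\pm=Y'^\pm$, and this holds if and only if $G=H$. Here an algorithm is a finite while program with arrays of registers for natural numbers, vertices of $T$ and elements of $\mathrm{Aut}(T)$. It may do integer arithmetic and comparisons; multiply, invert and test equality of automorphisms; apply an automorphism to a vertex; test equality of vertices; compute the distance $d(u,w)$ and the $k$-th vertex of the path $[u,w]$; and decide whether $[v_0,u]<[v_0,w]$. A single program works for all $T$, $v_0$, $(<_i)_i$, $X$ and $Y$. -/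

import Mathlib

namespace TreeAut

/-! ### Trees, translation lengths, purely hyperbolic groups -/

/-- A point of the geometric realisation of `T`: the point at distance `t` from `u` on the edge
from `u` to `v`.  When `u = v` it is the vertex `u`.  (Points have several representations.) -/
structure Point {V : Type*} (T : SimpleGraph V) where
  u : V
  v : V
  eq_or_adj : u = v ∨ T.Adj u v
  t : ℝ
  nonneg : 0 ≤ t
  le_one : t ≤ 1

/-- The distance from a point of the realisation of a tree to a vertex `x`.  In a tree it is affine
along every edge. -/
noncomputable def Point.distVertex {V : Type*} {T : SimpleGraph V} (p : Point T) (x : V) : ℝ :=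
  (1 - p.t) * (T.dist p.u x : ℝ) + p.t * (T.dist p.v x : ℝ)

open Classical in
/-- The path metric on the realisation of a tree.  Two points on the same edge are compared along
that edge; otherwise the distance from `q` is affine along the edge that carries `p`. -/
noncomputable def Point.dist {V : Type*} {T : SimpleGraph V} (p q : Point T) : ℝ :=
  if s(p.u, p.v) = s(q.u, q.v) then |p.distVertex p.u - q.distVertex p.u|
  else (1 - p.t) * q.distVertex p.u + p.t * q.distVertex p.v

/-- The action of an automorphism on the realisation. -/
def Point.map {V : Type*} {T : SimpleGraph V} (g : T ≃g T) (p : Point T) : Point T where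
  u := g p.u
  v := g p.v
  eq_or_adj := p.eq_or_adj.imp (fun h => congrArg g h) (fun h => g.map_rel_iff.2 h)
  t := p.t
  nonneg := p.nonneg
  le_one := p.le_one

/-- `l(g) = min {d(w, g w)}`, over all points `w` of the realisation (so that an inversion of an
edge has translation length `0`). -/
noncomputable def translationLength {V : Type*} {T : SimpleGraph V} (g : T ≃g T) : ℝ :=
  ⨅ p : Point T, p.dist (p.map g)

def Hyperbolic {V : Type*} {T : SimpleGraph V} (g : T ≃g T) : Prop :=
  0 < translationLength g

def PurelyHyperbolic {V : Type*} {T : SimpleGraph V} (G : Subgroup (T ≃g T)) : Prop :=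
  ∀ g ∈ G, g ≠ 1 → Hyperbolic g

/-! ### Paths and the orderings -/

/-- The vertex in position `k` (counted from `0`) of the path `[u, w]`; it is `w` if `k` exceeds
the length of that path. -/
noncomputable def pathVertex {V : Type*} {T : SimpleGraph V} (hT : T.IsTree) (u w : V) (k : ℕ) :
    V :=
  (hT.existsUnique_path u w).choose.getVert k

/-- A choice of lexicographic well-orderings `<_i` on the sets `P_i` of paths of length `i` that
start at `o`.  A path that starts at `o` is represented by its last vertex, which determines it
since `T` is a tree; its initial subpath of length `j` is represented by its vertex in
position `j`. -/
structure PathOrder {V : Type*} {T : SimpleGraph V} (hT : T.IsTree) (o : V) where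
  lt : ℕ → V → V → Prop
  wellOrder : ∀ i : ℕ, IsWellOrder {v : V // T.dist o v = i} (fun a b => lt i a b)
  lex : ∀ i j : ℕ, j < i → ∀ v w : V, T.dist o v = i → T.dist o w = i →
    lt j (pathVertex hT o v j) (pathVertex hT o w j) → lt i v w

/-- The ordering `[o, v] < [o, w]` on all paths that start at `o`: shorter paths come first, and
paths of equal length `i` are compared by `<_i`. -/
def PathOrder.PathLT {V : Type*} {T : SimpleGraph V} {hT : T.IsTree} {o : V}
    (R : PathOrder hT o) (v w : V) : Prop :=
  T.dist o v < T.dist o w ∨ (T.dist o v = T.dist o w ∧ R.lt (T.dist o v) v w)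

open Classical in
/-- The smaller of two paths. -/
noncomputable def PathOrder.lower {V : Type*} {T : SimpleGraph V} {hT : T.IsTree} {o : V}
    (R : PathOrder hT o) (v w : V) : V :=
  if R.PathLT w v then w else v

open Classical in
/-- The larger of two paths. -/
noncomputable def PathOrder.upper {V : Type*} {T : SimpleGraph V} {hT : T.IsTree} {o : V}
    (R : PathOrder hT o) (v w : V) : V :=
  if R.PathLT w v then v else w

/-- The ordering `{a, b} ≺ {c, d}` on unordered pairs of paths: the smallest path that the two
pairs do not have in common (counted with multiplicity) belongs to `{a, b}`.  Equivalently, compare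
the smaller members first and then the larger ones. -/
def PathOrder.PairLT {V : Type*} {T : SimpleGraph V} {hT : T.IsTree} {o : V}
    (R : PathOrder hT o) (a b c d : V) : Prop :=
  R.PathLT (R.lower a b) (R.lower c d) ∨
    (R.lower a b = R.lower c d ∧ R.PathLT (R.upper a b) (R.upper c d))

/-- `|g| = d(o, g o)`. -/
noncomputable def len {V : Type*} {T : SimpleGraph V} (o : V) (g : T ≃g T) : ℕ :=
  T.dist o (g o)

/-- The initial half `H(g)` of `[o, g o]`, of length `⌊|g| / 2⌋`, represented by its last vertex. -/
noncomputable def initialHalf {V : Type*} {T : SimpleGraph V} (hT : T.IsTree) (o : V)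
    (g : T ≃g T) : V :=
  pathVertex hT o (g o) (len o g / 2)

/-- `g <⋆ h`: either `|g| < |h|`, or `|g| = |h|` and `{H(g), H(g⁻¹)} ≺ {H(h), H(h⁻¹)}`. -/
def PathOrder.StarLT {V : Type*} {T : SimpleGraph V} {hT : T.IsTree} {o : V}
    (R : PathOrder hT o) (g h : T ≃g T) : Prop :=
  len o g < len o h ∨ (len o g = len o h ∧
    R.PairLT (initialHalf hT o g) (initialHalf hT o g⁻¹)
      (initialHalf hT o h) (initialHalf hT o h⁻¹))

/-! ### Strongly N-reduced bases -/

/-- `S^± = S ∪ S⁻¹`. -/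
def symmetrize {A : Type*} [Group A] (S : Set A) : Set A :=
  {g | g ∈ S ∨ g⁻¹ ∈ S}

/-- `S` is a free basis of the subgroup `G`. -/
def IsFreeBasis {A : Type*} [Group A] (S : Set A) (G : Subgroup A) : Prop :=
  Function.Injective (FreeGroup.lift (fun x : S => (x : A))) ∧ Subgroup.closure S = G

/-- `S` is a free basis of `G` that is strongly N-reduced with respect to `o` and `<⋆`. -/
structure StronglyNReduced {V : Type*} {T : SimpleGraph V} {hT : T.IsTree} {o : V}
    (R : PathOrder hT o) (S : Set (T ≃g T)) (G : Subgroup (T ≃g T)) : Prop where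
  freeBasis : IsFreeBasis S G
  n1 : ∀ x ∈ S, x⁻¹ ∉ S
  n4 : ∀ x ∈ symmetrize S, ∀ y ∈ symmetrize S, x ≠ y⁻¹ → R.StarLT x (x * y)

/-! ### Algorithms

Algorithms are finite while programs with three arrays of registers, which hold natural numbers,
vertices of `T` and automorphisms of `T`.  Vertices and automorphisms are atomic data: the only
access to them is through the primitive operations below.  A program is a purely syntactic object
that does not mention the tree, so that one program runs on all trees. -/

/-- Expressions for natural numbers.  Registers have computed addresses; subtraction is truncated
and division is rounded down. -/
inductive NatExp : Type
  | const (n : ℕ) : NatExp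
  | reg (i : NatExp) : NatExp
  | add (a b : NatExp) : NatExp
  | sub (a b : NatExp) : NatExp
  | mul (a b : NatExp) : NatExp
  | div (a b : NatExp) : NatExp

/-- Expressions for automorphisms. -/
inductive AutExp : Type
  | one : AutExp
  | reg (i : NatExp) : AutExp
  | mul (g h : AutExp) : AutExp
  | inv (g : AutExp) : AutExp

/-- Expressions for vertices: the base vertex, a register, the image of a vertex under an
automorphism, and the vertex in position `k` of the path `[u, w]`. -/
inductive VtxExp : Type
  | base : VtxExp
  | reg (i : NatExp) : VtxExp
  | act (g : AutExp) (v : VtxExp) : VtxExp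
  | along (u w : VtxExp) (k : NatExp) : VtxExp

/-- Tests: comparisons of numbers, equality of vertices and of automorphisms, the comparison
`[o, u] < [o, w]` of paths, and Boolean combinations. -/
inductive Test : Type
  | natEq (a b : NatExp) : Test
  | natLT (a b : NatExp) : Test
  | vtxEq (u w : VtxExp) : Test
  | autEq (g h : AutExp) : Test
  | pathLT (u w : VtxExp) : Test
  | not (b : Test) : Test
  | and (b c : Test) : Test

/-- Programs.  `setDist i u w` stores the distance `d(u, w)` in a number register. -/
inductive Program : Type
  | skip : Program
  | setNat (i : NatExp) (a : NatExp) : Program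
  | setDist (i : NatExp) (u w : VtxExp) : Program
  | setVtx (i : NatExp) (v : VtxExp) : Program
  | setAut (i : NatExp) (g : AutExp) : Program
  | seq (P Q : Program) : Program
  | ite (b : Test) (P Q : Program) : Program
  | loop (b : Test) (P : Program) : Program

/-- The contents of the registers. -/
structure Memory {V : Type*} (T : SimpleGraph V) where
  nat : ℕ → ℕ
  vtx : ℕ → V
  aut : ℕ → (T ≃g T)

def NatExp.eval {V : Type*} {T : SimpleGraph V} (m : Memory T) : NatExp → ℕ
  | .const n => n
  | .reg i => m.nat (i.eval m)
  | .add a b => a.eval m + b.eval m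
  | .sub a b => a.eval m - b.eval m
  | .mul a b => a.eval m * b.eval m
  | .div a b => a.eval m / b.eval m

def AutExp.eval {V : Type*} {T : SimpleGraph V} (m : Memory T) : AutExp → (T ≃g T)
  | .one => 1
  | .reg i => m.aut (i.eval m)
  | .mul g h => g.eval m * h.eval m
  | .inv g => (g.eval m)⁻¹

noncomputable def VtxExp.eval {V : Type*} {T : SimpleGraph V} (hT : T.IsTree) (o : V)
    (m : Memory T) : VtxExp → V
  | .base => o
  | .reg i => m.vtx (i.eval m)
  | .act g v => (g.eval m) (v.eval hT o m)
  | .along u w k => pathVertex hT (u.eval hT o m) (w.eval hT o m) (k.eval m)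

def Test.Holds {V : Type*} {T : SimpleGraph V} {hT : T.IsTree} {o : V} (R : PathOrder hT o)
    (m : Memory T) : Test → Prop
  | .natEq a b => a.eval m = b.eval m
  | .natLT a b => a.eval m < b.eval m
  | .vtxEq u w => u.eval hT o m = w.eval hT o m
  | .autEq g h => g.eval m = h.eval m
  | .pathLT u w => R.PathLT (u.eval hT o m) (w.eval hT o m)
  | .not b => ¬ b.Holds R m
  | .and b c => b.Holds R m ∧ c.Holds R m

/-- `Exec R P m m'`: the program `P`, started with memory `m`, halts with memory `m'`. -/
inductive Exec {V : Type*} {T : SimpleGraph V} {hT : T.IsTree} {o : V} (R : PathOrder hT o) :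
    Program → Memory T → Memory T → Prop
  | skip (m : Memory T) : Exec R .skip m m
  | setNat (i : NatExp) (a : NatExp) (m : Memory T) :
      Exec R (.setNat i a) m
        ⟨Function.update m.nat (i.eval m) (a.eval m), m.vtx, m.aut⟩
  | setDist (i : NatExp) (u w : VtxExp) (m : Memory T) :
      Exec R (.setDist i u w) m
        ⟨Function.update m.nat (i.eval m) (T.dist (u.eval hT o m) (w.eval hT o m)), m.vtx, m.aut⟩
  | setVtx (i : NatExp) (v : VtxExp) (m : Memory T) :
      Exec R (.setVtx i v) m
        ⟨m.nat, Function.update m.vtx (i.eval m) (v.eval hT o m), m.aut⟩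
  | setAut (i : NatExp) (g : AutExp) (m : Memory T) :
      Exec R (.setAut i g) m
        ⟨m.nat, m.vtx, Function.update m.aut (i.eval m) (g.eval m)⟩
  | seq (P Q : Program) (m₁ m₂ m₃ : Memory T) :
      Exec R P m₁ m₂ → Exec R Q m₂ m₃ → Exec R (.seq P Q) m₁ m₃
  | iteTrue (b : Test) (P Q : Program) (m m' : Memory T) :
      b.Holds R m → Exec R P m m' → Exec R (.ite b P Q) m m'
  | iteFalse (b : Test) (P Q : Program) (m m' : Memory T) :
      ¬ b.Holds R m → Exec R Q m m' → Exec R (.ite b P Q) m m'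
  | loopDone (b : Test) (P : Program) (m : Memory T) :
      ¬ b.Holds R m → Exec R (.loop b P) m m
  | loopStep (b : Test) (P : Program) (m₁ m₂ m₃ : Memory T) :
      b.Holds R m₁ → Exec R P m₁ m₂ → Exec R (.loop b P) m₂ m₃ → Exec R (.loop b P) m₁ m₃

/-- The initial memory for the input `X, Y`: the lengths of the two lists are in the number
registers `0` and `1`, and the members of `X`, followed by those of `Y`, are in the first
automorphism registers.  All other registers hold `0`, `o` and `1`. -/
def input {V : Type*} {T : SimpleGraph V} (o : V) (X Y : List (T ≃g T)) : Memory T where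
  nat := fun i => if i = 0 then X.length else if i = 1 then Y.length else 0
  vtx := fun _ => o
  aut := fun i => (X ++ Y).getD i 1

/-- The final memory `m` holds the answer `b` (as `1` or `0`) and the lists `X'` and `Y'`: the
answer is in the number register `0`, the lengths of the lists are in the number registers `1` and
`2`, and their members are in the first automorphism registers. -/
structure Output {V : Type*} {T : SimpleGraph V} (m : Memory T) (b : Bool)
    (X' Y' : List (T ≃g T)) : Prop where
  answer : m.nat 0 = b.toNat
  length_fst : m.nat 1 = X'.length
  length_snd : m.nat 2 = Y'.length
  members : ∀ i < (X' ++ Y').length, (X' ++ Y')[i]? = some (m.aut i)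

end TreeAut

namespace TreeAut

open SimpleGraph

/-! ### Geodesics in trees -/

section Tree

variable {V : Type*} {T : SimpleGraph V} (hT : T.IsTree)

/-! The argument is Nielsen reduction, with cancellation read off from geodesics. The initial
segment shared by `[o, g⁻¹ o]` and `[o, h o]` has length `cancel g⁻¹ h`, and `|gh| = |g| + |h| - 2
cancel g⁻¹ h` (`len_mul`). The working condition on a symmetric set is `CancelReduced`: a product of
two non-inverse letters cancels at most half of either factor, and cancels exactly half of the right
factor `y` only if `H(y)` precedes `H(y⁻¹)`.

The tie-break prevents the two neighbours of a letter from consuming all of it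
(`cancel_add_cancel_lt`). Cancellation in a reduced word is therefore local (`cancel_prod`). Hence
nonempty reduced words are nontrivial, which gives freeness, and every letter of a reduced word of
length at least two is `<⋆`-smaller than the product (`mem_starLT_prod`). It follows that `S^±`
consists of exactly those elements of the group that do not lie in the subgroup generated by the
`<⋆`-smaller ones (`symmetrize_eq`). This description mentions only the group and the order, so
equality of groups amounts to equality of symmetrized bases (`StronglyNReduced.eq_iff`).

A basis is found by replacing one entry of the generating tuple by a `<⋆`-smaller product as long as
`Reducible` permits. This stops because `<⋆` is well-founded, even for trees that are not locally
finite. Pure hyperbolicity enters twice: a nontrivial `g` cancels less than half against itself, so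
pairs `(g, g)` need no test, and the halves of a nontrivial element of even length differ, so the
tie-break always decides. When no move is left, the nontrivial entries satisfy `CancelReduced`. -/

theorem length_eq_dist_of_isPath (hT : T.IsTree) {u w : V} (p : T.Walk u w) (hp : p.IsPath) :
    p.length = T.dist u w := by
  obtain ⟨q, hq, hl⟩ := hT.1.exists_path_of_dist u w
  rw [(hT.existsUnique_path u w).unique hp hq, hl]

theorem pathVertex_eq_getVert {u w : V} (p : T.Walk u w) (hp : p.IsPath) (k : ℕ) :
    pathVertex hT u w k = p.getVert k := by
  rw [pathVertex, (hT.existsUnique_path u w).unique (hT.existsUnique_path u w).choose_spec.1 hp]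

theorem dist_left_pathVertex {u w : V} {k : ℕ} (hk : k ≤ T.dist u w) :
    T.dist u (pathVertex hT u w k) = k := by
  obtain ⟨p, hp, hl⟩ := hT.1.exists_path_of_dist u w
  rw [pathVertex_eq_getVert hT p hp, ← length_eq_dist_of_isPath hT _ (hp.take k),
    Walk.take_length, hl, min_eq_left hk]

theorem dist_pathVertex_right {u w : V} {k : ℕ} (hk : k ≤ T.dist u w) :
    k + T.dist (pathVertex hT u w k) w = T.dist u w := by
  obtain ⟨p, hp, hl⟩ := hT.1.exists_path_of_dist u w
  rw [pathVertex_eq_getVert hT p hp, ← length_eq_dist_of_isPath hT _ (hp.drop k),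
    Walk.drop_length, hl, Nat.add_sub_cancel' hk]

/-- Joining geodesics through `x` gives a walk of length `d(u, w)`, hence the unique path, and that
path passes through `x`. -/
theorem pathVertex_dist_of_between {u w x : V} (h : T.dist u x + T.dist x w ≤ T.dist u w) :
    pathVertex hT u w (T.dist u x) = x := by
  obtain ⟨p, hp, hl⟩ := hT.1.exists_path_of_dist u x
  obtain ⟨q, hq, hl'⟩ := hT.1.exists_path_of_dist x w
  have hpq : (p.append q).IsPath := by
    apply Walk.isPath_of_length_eq_dist
    rw [Walk.length_append, hl, hl']
    exact le_antisymm h hT.1.dist_triangle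
  rw [pathVertex_eq_getVert hT _ hpq, Walk.getVert_append, hl]
  simp

theorem eq_pathVertex {u w x : V} {k : ℕ} (h : T.dist u x = k)
    (h' : T.dist u x + T.dist x w ≤ T.dist u w) : pathVertex hT u w k = x := by
  rw [← h, pathVertex_dist_of_between hT h']

theorem pathVertex_pathVertex {u w : V} {j k : ℕ} (hj : j ≤ k) (hk : k ≤ T.dist u w) :
    pathVertex hT u (pathVertex hT u w k) j = pathVertex hT u w j := by
  have h1 := dist_left_pathVertex hT hk
  have h2 := dist_pathVertex_right hT hk
  have h3 : j ≤ T.dist u (pathVertex hT u w k) := h1.symm ▸ hj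
  have h4 := dist_left_pathVertex hT h3
  have h5 := dist_pathVertex_right hT h3
  symm
  apply eq_pathVertex hT h4
  have := hT.1.dist_triangle (u := pathVertex hT u (pathVertex hT u w k) j)
    (v := pathVertex hT u w k) (w := w)
  omega

theorem pathVertex_length (u w : V) : pathVertex hT u w (T.dist u w) = w :=
  eq_pathVertex hT rfl (by simp)

theorem pathVertex_reverse {u w : V} {k : ℕ} (hk : k ≤ T.dist u w) :
    pathVertex hT w u k = pathVertex hT u w (T.dist u w - k) := by
  have h1 := dist_left_pathVertex hT (Nat.sub_le (T.dist u w) k)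
  have h2 := dist_pathVertex_right hT (Nat.sub_le (T.dist u w) k)
  apply eq_pathVertex hT
  · rw [dist_comm]; omega
  · rw [dist_comm, dist_comm (v := u), dist_comm (u := w) (v := u)]; omega

theorem dist_map_map (hT : T.IsTree) (g : T ≃g T) (u w : V) : T.dist (g u) (g w) = T.dist u w := by
  obtain ⟨p, hp, hl⟩ := hT.1.exists_path_of_dist u w
  have := length_eq_dist_of_isPath hT (p.map (g : T →g T)) (hp.map g.injective)
  rw [Walk.length_map, hl] at this
  exact this.symm

theorem pathVertex_map (g : T ≃g T) {u w : V} {k : ℕ} (hk : k ≤ T.dist u w) :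
    pathVertex hT (g u) (g w) k = g (pathVertex hT u w k) := by
  apply eq_pathVertex hT
  · rw [dist_map_map hT, dist_left_pathVertex hT hk]
  · rw [dist_map_map hT, dist_map_map hT, dist_map_map hT, dist_left_pathVertex hT hk,
      dist_pathVertex_right hT hk]

/-! ### Branching of geodesics from the base vertex -/

open Classical in
/-- The length of the longest common initial segment of `[o, v]` and `[o, w]`. -/
noncomputable def overlap (o v w : V) : ℕ :=
  Nat.findGreatest (fun k => pathVertex hT o v k = pathVertex hT o w k)
    (min (T.dist o v) (T.dist o w))

/-- Two geodesics from `o` that agree in one position agree in all earlier ones, so the greatest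
position of agreement is a threshold. -/
theorem le_overlap_iff {o v w : V} {k : ℕ} : k ≤ overlap hT o v w ↔
    k ≤ T.dist o v ∧ k ≤ T.dist o w ∧ pathVertex hT o v k = pathVertex hT o w k := by
  classical
  have h0 : pathVertex hT o v 0 = pathVertex hT o w 0 := by
    simp [pathVertex]
  constructor
  · intro h
    have hs := Nat.findGreatest_spec (P := fun k => pathVertex hT o v k = pathVertex hT o w k)
      (Nat.zero_le (min (T.dist o v) (T.dist o w))) h0
    have hle := Nat.findGreatest_le (P := fun k => pathVertex hT o v k = pathVertex hT o w k)
      (min (T.dist o v) (T.dist o w))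
    rw [overlap] at h
    have h1 := (h.trans hle).trans (min_le_left _ _)
    have h2 := (h.trans hle).trans (min_le_right _ _)
    refine ⟨h1, h2, ?_⟩
    rw [← pathVertex_pathVertex hT h (hle.trans (min_le_left _ _)), hs,
      pathVertex_pathVertex hT h (hle.trans (min_le_right _ _))]
  · rintro ⟨h1, h2, h3⟩
    exact Nat.le_findGreatest (le_min h1 h2) h3

theorem overlap_comm (o v w : V) : overlap hT o v w = overlap hT o w v :=
  eq_of_forall_le_iff fun k => by
    rw [le_overlap_iff, le_overlap_iff]
    exact ⟨fun h => ⟨h.2.1, h.1, h.2.2.symm⟩, fun h => ⟨h.2.1, h.1, h.2.2.symm⟩⟩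

theorem le_overlap_trans {o u v w : V} {k : ℕ} (h : k ≤ overlap hT o u v)
    (h' : k ≤ overlap hT o v w) : k ≤ overlap hT o u w := by
  rw [le_overlap_iff] at *
  exact ⟨h.1, h'.2.1, h.2.2.trans h'.2.2⟩

/-- The ultrametric property: agreement up to level `k` is transitive, so the smaller of two
distinct overlaps is inherited. -/
theorem overlap_eq_of_lt {o u v w : V} (h : overlap hT o u v < overlap hT o v w) :
    overlap hT o u w = overlap hT o u v := by
  apply le_antisymm
  · by_contra! hlt
    have : overlap hT o u v + 1 ≤ overlap hT o u v :=
      le_overlap_trans hT (v := w) hlt (by rw [overlap_comm hT o w v]; exact h)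
    omega
  · exact le_overlap_trans hT le_rfl h.le

theorem dist_add_dist_of_mem_support (hT : T.IsTree) {u w x : V} {p : T.Walk u w} (hp : p.IsPath)
    (hx : x ∈ p.support) : T.dist u x + T.dist x w = T.dist u w := by
  classical
  rw [← length_eq_dist_of_isPath hT _ (hp.takeUntil hx),
    ← length_eq_dist_of_isPath hT _ (hp.dropUntil hx), ← length_eq_dist_of_isPath hT p hp,
    ← Walk.length_append, Walk.take_spec]

/-- The overlap is the Gromov product of `v` and `w` at `o`. The geodesics from `v` and `w` to the
branch point `x` meet only there: a further common vertex would lie on both geodesics from `o`,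
beyond the last position of agreement. Their union is thus the path `[v, w]`. -/
theorem dist_add_two_mul_overlap (o v w : V) :
    T.dist v w + 2 * overlap hT o v w = T.dist o v + T.dist o w := by
  obtain ⟨hv, hw, he⟩ := (le_overlap_iff hT (o := o) (v := v) (w := w)).1 le_rfl
  set c := overlap hT o v w with hc
  set x := pathVertex hT o v c with hx
  have h1 := dist_left_pathVertex hT hv
  have h2 := dist_pathVertex_right hT hv
  have h3 := dist_pathVertex_right hT hw
  rw [← he] at h3
  rw [← hx] at h1 h2
  obtain ⟨p, hp, hpl⟩ := hT.1.exists_path_of_dist v x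
  obtain ⟨q, hq, hql⟩ := hT.1.exists_path_of_dist x w
  have hpq : (p.append q).IsPath := by
    rw [Walk.isPath_def, Walk.support_append, List.nodup_append]
    have hqn := hq.support_nodup
    rw [← Walk.cons_tail_support, List.nodup_cons] at hqn
    refine ⟨hp.support_nodup, hqn.2, ?_⟩
    rintro y hy _ hy' rfl
    have e1 := dist_add_dist_of_mem_support hT hp hy
    have e2 := dist_add_dist_of_mem_support hT hq (List.mem_of_mem_tail hy')
    have t1 := hT.1.dist_triangle (u := o) (v := x) (w := y)
    have t2 := hT.1.dist_triangle (u := o) (v := y) (w := v)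
    rw [T.dist_comm (u := v) (v := y), T.dist_comm (u := y) (v := x),
      T.dist_comm (u := v) (v := x)] at e1
    have f1 := pathVertex_dist_of_between hT (u := o) (w := v) (x := y) (by omega)
    have f2 := pathVertex_dist_of_between hT (u := o) (w := w) (x := y) (by omega)
    have : T.dist o y ≤ c :=
      (le_overlap_iff hT).2 ⟨by omega, by omega, f1.trans f2.symm⟩
    have hxy : T.dist x y = 0 := by omega
    rw [hT.1.dist_eq_zero_iff] at hxy
    exact hqn.1 (hxy ▸ hy')
  have := length_eq_dist_of_isPath hT _ hpq
  rw [Walk.length_append, hpl, hql, T.dist_comm (u := v) (v := x)] at this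
  omega

end Tree

section Order

variable {V : Type*} {T : SimpleGraph V} {hT : T.IsTree} {o : V} (R : PathOrder hT o)

/-! ### The orderings of paths, pairs and automorphisms -/

namespace PathOrder

/-- Lexicographic combination of the order on lengths with a well-order on each level; no finiteness
of the levels is needed. -/
theorem wellFounded_pathLT : WellFounded R.PathLT := by
  have hwf : WellFounded (PSigma.Lex (α := ℕ) (β := fun i => {v : V // T.dist o v = i}) (· < ·)
      (fun i a b => R.lt i a b)) :=
    ⟨fun ⟨i, v⟩ => PSigma.lexAccessible (Nat.lt_wfRel.wf.apply i)
      (fun i => (R.wellOrder i).toIsWellFounded.wf) v⟩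
  refine Subrelation.wf ?_ (InvImage.wf (fun v : V => ⟨T.dist o v, v, rfl⟩) hwf)
  have aux : ∀ (i j : ℕ) (a : {v : V // T.dist o v = i}) (b : {v : V // T.dist o v = j}),
      i = j → R.lt i a b → PSigma.Lex (α := ℕ) (β := fun i => {v : V // T.dist o v = i}) (· < ·)
      (fun i a b => R.lt i a b) ⟨i, a⟩ ⟨j, b⟩ := by
    rintro i _ a b rfl h
    exact .right _ h
  rintro v w (h | ⟨h, h'⟩)
  · exact .left _ _ h
  · exact aux _ _ _ _ h h'

theorem pathLT_trans {u v w : V} (h : R.PathLT u v) (h' : R.PathLT v w) : R.PathLT u w := by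
  rcases h with h | ⟨h, hl⟩ <;> rcases h' with h' | ⟨h', hl'⟩
  · exact .inl (h.trans h')
  · exact .inl (h' ▸ h)
  · exact .inl (h ▸ h')
  · refine .inr ⟨h.trans h', ?_⟩
    have := R.wellOrder (T.dist o u)
    rw [← h] at hl'
    exact trans_of (fun a b : {x : V // T.dist o x = T.dist o u} => R.lt (T.dist o u) a b)
      (a := ⟨u, rfl⟩) (b := ⟨v, h.symm⟩) (c := ⟨w, (h.trans h').symm⟩) hl hl'

theorem pathLT_asymm {v w : V} (h : R.PathLT v w) : ¬ R.PathLT w v :=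
  R.wellFounded_pathLT.asymmetric _ _ h

theorem pathLT_trichotomy (v w : V) : R.PathLT v w ∨ v = w ∨ R.PathLT w v := by
  rcases lt_trichotomy (T.dist o v) (T.dist o w) with h | h | h
  · exact .inl (.inl h)
  · have := R.wellOrder (T.dist o v)
    rcases trichotomous_of (fun a b : {x : V // T.dist o x = T.dist o v} => R.lt (T.dist o v) a b)
      ⟨v, rfl⟩ ⟨w, h.symm⟩ with h' | h' | h'
    · exact .inl (.inr ⟨h, h'⟩)
    · exact .inr (.inl (congrArg Subtype.val h'))
    · exact .inr (.inr (.inr ⟨h.symm, h ▸ h'⟩))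
  · exact .inr (.inr (.inl h))

/-- This is how the lexicographic axiom on the `<_i` enters: a comparison of halves may be settled
on shorter initial segments. -/
theorem pathLT_of_prefix {i j : ℕ} (hj : j ≤ i) {v w : V} (hv : T.dist o v = i)
    (hw : T.dist o w = i) (h : R.PathLT (pathVertex hT o v j) (pathVertex hT o w j)) :
    R.PathLT v w := by
  have h1 := dist_left_pathVertex hT (hv ▸ hj : j ≤ T.dist o v)
  have h2 := dist_left_pathVertex hT (hw ▸ hj : j ≤ T.dist o w)
  rcases hj.lt_or_eq with hlt | rfl
  · rcases h with h | ⟨-, h⟩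
    · omega
    · rw [h1] at h
      refine .inr ⟨hv.trans hw.symm, ?_⟩
      rw [hv]
      exact R.lex i j hlt v w hv hw h
  · rw [← hv, pathVertex_length, hv, ← hw, pathVertex_length] at h
    exact h

theorem lower_comm (v w : V) : R.lower v w = R.lower w v := by
  rcases R.pathLT_trichotomy v w with h | rfl | h
  · simp [lower, h, R.pathLT_asymm h]
  · rfl
  · simp [lower, h, R.pathLT_asymm h]

theorem upper_comm (v w : V) : R.upper v w = R.upper w v := by
  rcases R.pathLT_trichotomy v w with h | rfl | h
  · simp [upper, h, R.pathLT_asymm h]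
  · rfl
  · simp [upper, h, R.pathLT_asymm h]

theorem pairLT_of_pathLT (a : V) {b c : V} (h : R.PathLT b c) : R.PairLT a b a c := by
  by_cases hb : R.PathLT b a <;> by_cases hc : R.PathLT c a
  · simp [PairLT, lower, hb, hc, h]
  · simp [PairLT, lower, hb, hc]
  · exact absurd (R.pathLT_trans h hc) hb
  · simp [PairLT, lower, upper, hb, hc, h]

/-- The data that `<⋆` compares lexicographically. -/
noncomputable def starKey (g : T ≃g T) : ℕ × V × V :=
  (len o g, R.lower (initialHalf hT o g) (initialHalf hT o g⁻¹),
    R.upper (initialHalf hT o g) (initialHalf hT o g⁻¹))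

theorem starLT_iff (g h : T ≃g T) : R.StarLT g h ↔
    Prod.Lex (· < ·) (Prod.Lex R.PathLT R.PathLT) (R.starKey g) (R.starKey h) := by
  simp only [Prod.lex_def]
  rfl

/-- Termination of the reduction rests on this. The order is pulled back along `starKey`, which need
not be injective. -/
theorem wellFounded_starLT : WellFounded R.StarLT :=
  Subrelation.wf (fun h => (R.starLT_iff _ _).1 h)
    (InvImage.wf R.starKey
      (WellFounded.prod_lex Nat.lt_wfRel.wf
        (WellFounded.prod_lex R.wellFounded_pathLT R.wellFounded_pathLT)))

theorem starLT_trans {f g h : T ≃g T} (h₁ : R.StarLT f g) (h₂ : R.StarLT g h) :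
    R.StarLT f h := by
  have : IsTrans V R.PathLT := ⟨fun _ _ _ => R.pathLT_trans⟩
  rw [starLT_iff] at *
  exact _root_.trans h₁ h₂

theorem starLT_asymm {g h : T ≃g T} (h₁ : R.StarLT g h) : ¬ R.StarLT h g :=
  R.wellFounded_starLT.asymmetric _ _ h₁

theorem starLT_irrefl (g : T ≃g T) : ¬ R.StarLT g g :=
  fun h => R.starLT_asymm h h

end PathOrder

theorem len_inv (hT : T.IsTree) (g : T ≃g T) : len o g⁻¹ = len o g := by
  rw [len, ← dist_map_map hT g, RelIso.apply_inv_self, dist_comm, len]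

namespace PathOrder

/-- The pair of halves is unordered, so `<⋆` cannot distinguish an element from its inverse. A
letter may thus stand for either. -/
theorem starKey_inv (g : T ≃g T) : R.starKey g⁻¹ = R.starKey g := by
  simp only [starKey, len_inv hT, inv_inv]
  rw [R.lower_comm, R.upper_comm]

theorem starLT_inv_left {g h : T ≃g T} : R.StarLT g⁻¹ h ↔ R.StarLT g h := by
  rw [starLT_iff, starLT_iff, starKey_inv]

theorem starLT_inv_right {g h : T ≃g T} : R.StarLT g h⁻¹ ↔ R.StarLT g h := by
  rw [starLT_iff, starLT_iff, starKey_inv]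

end PathOrder

/-! ### Cancellation -/

variable (hT o) in
/-- The length of the common initial segment of `[o, g o]` and `[o, h o]`. -/
noncomputable def cancel (g h : T ≃g T) : ℕ :=
  overlap hT o (g o) (h o)

theorem cancel_comm (g h : T ≃g T) : cancel hT o g h = cancel hT o h g :=
  overlap_comm hT _ _ _

theorem len_mul (g h : T ≃g T) :
    len o (g * h) + 2 * cancel hT o g⁻¹ h = len o g + len o h := by
  have := dist_add_two_mul_overlap hT o (g⁻¹ o) (h o)
  rw [← dist_map_map hT g, RelIso.apply_inv_self] at this
  change len o (g * h) + 2 * cancel hT o g⁻¹ h = len o g⁻¹ + len o h at this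
  rwa [len_inv hT] at this

/-- The part of `[o, g o]` that survives multiplication by `h` is the initial segment shared with
`[o, gh o]`; the rest is what cancels. -/
theorem cancel_mul_left (g h : T ≃g T) :
    cancel hT o (g * h) g + cancel hT o g⁻¹ h = len o g := by
  have h1 := len_mul (hT := hT) (o := o) g h
  have h2 := len_mul (hT := hT) (o := o) (g * h)⁻¹ g
  rw [inv_inv, len_inv hT, show (g * h)⁻¹ * g = h⁻¹ by group, len_inv hT] at h2
  omega

theorem initialHalf_dist (g : T ≃g T) : T.dist o (initialHalf hT o g) = len o g / 2 :=
  dist_left_pathVertex hT (Nat.div_le_self _ _)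

theorem pathVertex_inv (g : T ≃g T) {k : ℕ} (hk : k ≤ len o g) :
    g (pathVertex hT o (g⁻¹ o) k) = pathVertex hT o (g o) (len o g - k) := by
  rw [← pathVertex_map hT, RelIso.apply_inv_self, pathVertex_reverse hT hk, len]
  rwa [← len, len_inv hT]

/-- If `g` has even length and its halves agree, then it fixes the midpoint of `[o, g o]`. -/
theorem apply_initialHalf_of_even {g : T ≃g T} {k : ℕ} (hk : len o g = 2 * k)
    (h : initialHalf hT o g = initialHalf hT o g⁻¹) :
    g (initialHalf hT o g) = initialHalf hT o g := by
  conv_lhs => rw [h]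
  rw [initialHalf, pathVertex_inv g (by rw [len_inv hT]; exact Nat.div_le_self _ _), len_inv hT,
    initialHalf]
  congr 1
  omega

/-- The criterion by which right multiplication by `h` increases `g`. -/
theorem PathOrder.starLT_mul {g h : T ≃g T} (hg : 2 * cancel hT o g⁻¹ h ≤ len o g)
    (hh : 2 * cancel hT o g⁻¹ h ≤ len o h)
    (he : 2 * cancel hT o g⁻¹ h = len o h →
      R.PathLT (initialHalf hT o h) (initialHalf hT o h⁻¹)) :
    R.StarLT g (g * h) := by
  have hl := len_mul (hT := hT) (o := o) g h
  rcases hh.lt_or_eq with hlt | heq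
  · exact .inl (by omega)
  have hlen : len o (g * h) = len o g := by omega
  refine .inr ⟨hlen.symm, ?_⟩
  have hhalf : initialHalf hT o (g * h) = initialHalf hT o g := by
    have h1 := cancel_mul_left (hT := hT) (o := o) g h
    have h2 : len o g / 2 ≤ cancel hT o (g * h) g := by omega
    rw [initialHalf, hlen, ((le_overlap_iff hT).1 h2).2.2, initialHalf]
  rw [hhalf]
  apply R.pairLT_of_pathLT
  set c := cancel hT o g⁻¹ h with hc
  have hci : c ≤ len o g / 2 := by omega
  have hgi : len o g⁻¹ = len o g := len_inv hT g
  have hghi : len o (g * h)⁻¹ = len o (g * h) := len_inv hT (g * h)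
  refine R.pathLT_of_prefix hci (by rw [initialHalf_dist, hgi])
    (by rw [initialHalf_dist, hghi, hlen]) ?_
  -- In the tie case `c = |h| / 2`, the initial halves of `g⁻¹` and `(gh)⁻¹` begin with `H(h)` and
  -- `H(h⁻¹)` respectively. These prefixes decide the comparison.
  have e1 : pathVertex hT o (initialHalf hT o g⁻¹) c = initialHalf hT o h := by
    rw [initialHalf, hgi, pathVertex_pathVertex hT hci (by rw [← len, hgi]; omega),
      ((le_overlap_iff hT).1 hc.le).2.2, initialHalf, ← heq, Nat.mul_div_cancel_left _ two_pos]
  have e2 : pathVertex hT o (initialHalf hT o (g * h)⁻¹) c = initialHalf hT o h⁻¹ := by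
    have h1 := cancel_mul_left (hT := hT) (o := o) h⁻¹ g⁻¹
    rw [inv_inv, cancel_comm h, ← hc, len_inv hT, ← mul_inv_rev] at h1
    have h2 : c ≤ cancel hT o (g * h)⁻¹ h⁻¹ := by omega
    rw [initialHalf, hghi, hlen, pathVertex_pathVertex hT hci (by rw [← len, hghi, hlen]; omega),
      ((le_overlap_iff hT).1 h2).2.2, initialHalf, len_inv hT, ← heq,
      Nat.mul_div_cancel_left _ two_pos]
  rw [e1, e2]
  exact he heq

/-- The criterion by which right multiplication by `h` decreases `g` without shortening it. -/
theorem PathOrder.mul_starLT {g h : T ≃g T} (hl : len o (g * h) = len o g)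
    (hh : len o h ≤ len o g) (he : R.PathLT (initialHalf hT o h⁻¹) (initialHalf hT o h)) :
    R.StarLT (g * h) g := by
  have h1 := len_mul (hT := hT) (o := o) g h
  have h2 := cancel_mul_left (hT := hT) (o := o) h⁻¹ g⁻¹
  rw [inv_inv, cancel_comm h, len_inv hT, ← mul_inv_rev] at h2
  -- The previous criterion is applied to `g * h` and `h⁻¹`, whose product is `g`. Equal lengths
  -- mean that exactly half of `h` cancels.
  have h3 := R.starLT_mul (g := g * h) (h := h⁻¹) (by omega) (by rw [len_inv hT]; omega)
    (fun _ => by rwa [inv_inv])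
  rwa [mul_inv_cancel_right] at h3

/-! ### Purely hyperbolic groups -/

theorem Point.dist_nonneg (p q : Point T) : 0 ≤ p.dist q := by
  have h : ∀ (p : Point T) (x : V), 0 ≤ p.distVertex x := fun p x => by
    have := p.nonneg
    have := sub_nonneg.2 p.le_one
    unfold Point.distVertex
    positivity
  unfold Point.dist
  split_ifs
  · exact abs_nonneg _
  · have := p.nonneg
    have := sub_nonneg.2 p.le_one
    have := h q p.u
    have := h q p.v
    positivity

theorem not_hyperbolic_of_dist_eq_zero {g : T ≃g T} (p : Point T) (h : p.dist (p.map g) = 0) :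
    ¬ Hyperbolic g := by
  rw [Hyperbolic, not_lt, translationLength, ← h]
  exact ciInf_le ⟨0, by rintro _ ⟨q, rfl⟩; exact q.dist_nonneg _⟩ p

theorem not_hyperbolic_of_fixed_vertex {g : T ≃g T} {v : V} (h : g v = v) : ¬ Hyperbolic g := by
  refine not_hyperbolic_of_dist_eq_zero ⟨v, v, .inl rfl, 0, le_rfl, zero_le_one⟩ ?_
  simp [Point.dist, Point.map, h]

theorem not_hyperbolic_of_inverted_edge {g : T ≃g T} {v w : V} (hvw : T.Adj v w) (hv : g v = w)
    (hw : g w = v) : ¬ Hyperbolic g := by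
  refine not_hyperbolic_of_dist_eq_zero ⟨v, w, .inr hvw, 1 / 2, by norm_num, by norm_num⟩ ?_
  simp only [Point.dist, Point.map, hv, hw, Sym2.eq_swap, if_true, Point.distVertex]
  norm_num

/-- A hyperbolic automorphism cancels less than half against itself. -/
theorem Hyperbolic.two_mul_cancel_lt {g : T ≃g T} (hg : Hyperbolic g) :
    2 * cancel hT o g⁻¹ g < len o g := by
  by_contra! hle
  -- On the common initial segment `g` acts as the reflection of `[o, g o]`. If this segment reaches
  -- the middle, `g` fixes the middle vertex or inverts the middle edge, according to the parity of
  -- `|g|`.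
  have hpre : ∀ k, k ≤ cancel hT o g⁻¹ g → k ≤ len o g →
      g (pathVertex hT o (g o) k) = pathVertex hT o (g o) (len o g - k) := fun k hk hk' => by
    rw [← ((le_overlap_iff hT).1 hk).2.2, pathVertex_inv g hk']
  rcases Nat.even_or_odd' (len o g) with ⟨k, hk | hk⟩
  · refine not_hyperbolic_of_fixed_vertex (v := pathVertex hT o (g o) k) ?_ hg
    rw [hpre k (by omega) (by omega)]
    congr 1
    omega
  · refine not_hyperbolic_of_inverted_edge (v := pathVertex hT o (g o) k)
      (w := pathVertex hT o (g o) (k + 1)) ?_ ?_ ?_ hg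
    · have hk1 : k + 1 ≤ T.dist o (g o) := by rw [← len]; omega
      obtain ⟨p, hp, hl⟩ := hT.1.exists_path_of_dist o (g o)
      rw [pathVertex_eq_getVert hT p hp, pathVertex_eq_getVert hT p hp]
      exact p.adj_getVert_succ (by omega)
    · rw [hpre k (by omega) (by omega)]
      congr 1
      omega
    · rw [hpre (k + 1) (by omega) (by omega)]
      congr 1
      omega

end Order

section Words

variable {V : Type*} {T : SimpleGraph V} {hT : T.IsTree} {o : V}

/-! ### Words over a symmetric set with little cancellation -/

/-- A symmetric set in which every product of two elements that are not inverse to each other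
cancels at most half of each factor, and cancels the initial half of the right factor only if
this half precedes the terminal one. -/
structure CancelReduced (R : PathOrder hT o) (U : Set (T ≃g T)) : Prop where
  inv_mem : ∀ x ∈ U, x⁻¹ ∈ U
  len_pos : ∀ x ∈ U, 0 < len o x
  cancel_le_right : ∀ x ∈ U, ∀ y ∈ U, x ≠ y⁻¹ → 2 * cancel hT o x⁻¹ y ≤ len o y
  half_lt : ∀ x ∈ U, ∀ y ∈ U, x ≠ y⁻¹ → 2 * cancel hT o x⁻¹ y = len o y →
    R.PathLT (initialHalf hT o y) (initialHalf hT o y⁻¹)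

/-- Words over `U` without adjacent inverse letters. -/
structure ReducedWord {A : Type*} [Group A] (U : Set A) (l : List A) : Prop where
  mem : ∀ x ∈ l, x ∈ U
  chain : l.IsChain (fun a b => a ≠ b⁻¹)

theorem ReducedWord.tail {A : Type*} [Group A] {U : Set A} {x : A} {l : List A}
    (h : ReducedWord U (x :: l)) : ReducedWord U l :=
  ⟨fun y hy => h.mem y (List.mem_cons_of_mem x hy), h.chain.tail⟩

theorem ReducedWord.inv_reverse {A : Type*} [Group A] {U : Set A} (hU : ∀ x ∈ U, x⁻¹ ∈ U)
    {l : List A} (h : ReducedWord U l) : ReducedWord U (l.map (·⁻¹)).reverse := by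
  refine ⟨fun x hx => ?_, ?_⟩
  · simp only [List.mem_reverse, List.mem_map] at hx
    obtain ⟨y, hy, rfl⟩ := hx
    exact hU y (h.mem y hy)
  · rw [List.isChain_reverse, List.isChain_map]
    refine h.chain.imp fun a b hab hba => hab ?_
    rw [inv_inv] at hba
    exact hba.symm

/-- Left multiplication by a letter either extends a reduced word or removes its first letter. -/
theorem exists_reducedWord {A : Type*} [Group A] {S : Set A} {g : A}
    (hg : g ∈ Subgroup.closure S) : ∃ l, ReducedWord (symmetrize S) l ∧ l.prod = g := by
  have step : ∀ x ∈ symmetrize S, ∀ y, (∃ l, ReducedWord (symmetrize S) l ∧ l.prod = y) →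
      ∃ l, ReducedWord (symmetrize S) l ∧ l.prod = x * y := by
    rintro x hx y ⟨l, hl, rfl⟩
    cases l with
    | nil => exact ⟨[x], ⟨by simpa using hx, by simp⟩, by simp⟩
    | cons z l =>
      by_cases hxz : x = z⁻¹
      · exact ⟨l, hl.tail, by simp [hxz]⟩
      · refine ⟨x :: z :: l, ⟨?_, List.isChain_cons_cons.2 ⟨hxz, hl.chain⟩⟩, by simp⟩
        rintro w (_ | ⟨_, hw⟩)
        exacts [hx, hl.mem w hw]
  induction hg using Subgroup.closure_induction_left with
  | one => exact ⟨[], ⟨by simp, by simp⟩, rfl⟩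
  | mul_left x hx y _ ih => exact step x (.inl hx) y ih
  | inv_mul_cancel x hx y _ ih => exact step x⁻¹ (.inr (by simpa using hx)) y ih

theorem inv_mem_symmetrize {A : Type*} [Group A] {S : Set A} {x : A} (hx : x ∈ symmetrize S) :
    x⁻¹ ∈ symmetrize S := by
  rcases hx with hx | hx
  · exact .inr (by simpa using hx)
  · exact .inl hx

theorem symmetrize_subset_closure {A : Type*} [Group A] {S : Set A} {x : A}
    (hx : x ∈ symmetrize S) : x ∈ Subgroup.closure S := by
  rcases hx with hx | hx
  · exact Subgroup.subset_closure hx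
  · exact inv_inv x ▸ inv_mem (Subgroup.subset_closure hx)

namespace CancelReduced

variable {R : PathOrder hT o} {U : Set (T ≃g T)} (hU : CancelReduced R U)

include hU

theorem cancel_le_left {x y : T ≃g T} (hx : x ∈ U) (hy : y ∈ U) (hxy : x ≠ y⁻¹) :
    2 * cancel hT o x⁻¹ y ≤ len o x := by
  have := hU.cancel_le_right y⁻¹ (hU.inv_mem y hy) x⁻¹ (hU.inv_mem x hx)
    (by rw [inv_inv]; exact hxy.symm)
  rwa [inv_inv, cancel_comm, len_inv hT] at this

/-- If the two sides consumed all of `y`, each would take exactly half. The tie-break would then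
yield both `H(y) < H(y⁻¹)` and `H(y⁻¹) < H(y)`. -/
theorem cancel_add_cancel_lt {x y z : T ≃g T} (hx : x ∈ U) (hy : y ∈ U) (hz : z ∈ U)
    (hxy : x ≠ y⁻¹) (hyz : y ≠ z⁻¹) : cancel hT o x⁻¹ y + cancel hT o y⁻¹ z < len o y := by
  have hyz' : z⁻¹ ≠ y⁻¹⁻¹ := by rw [inv_inv]; exact hyz.symm
  have h1 := hU.cancel_le_right x hx y hy hxy
  have h2 := hU.cancel_le_left hy hz hyz
  by_contra! hle
  have h3 := hU.half_lt x hx y hy hxy (by omega)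
  have h4 := hU.half_lt z⁻¹ (hU.inv_mem z hz) y⁻¹ (hU.inv_mem y hy) hyz'
    (by rw [inv_inv, cancel_comm, len_inv hT]; omega)
  rw [inv_inv] at h4
  exact R.pathLT_asymm h3 h4

/-- Cancellation at the left end sees only the first letter. Some of `y` survives between its
neighbours, so `[o, z o]` leaves `[o, y o]` before the geodesic of the whole product does;
`overlap_eq_of_lt` then applies. -/
theorem cancel_prod {l : List (T ≃g T)} : ∀ {y z : T ≃g T}, ReducedWord U (y :: l) → z ∈ U →
    z ≠ y → cancel hT o (y * l.prod) z = cancel hT o y z := by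
  induction l with
  | nil => intros; simp
  | cons x l ih =>
    intro y z hw hz hzy
    have hy : y ∈ U := hw.mem y (by simp)
    have hx : x ∈ U := hw.mem x (by simp)
    have hyx : y ≠ x⁻¹ := (List.isChain_cons_cons.1 hw.chain).1
    have h1 := ih hw.tail (hU.inv_mem y hy) (fun h => hyx (by rw [← h, inv_inv]))
    have h2 := cancel_mul_left (hT := hT) (o := o) y (x * l.prod)
    have h3 := hU.cancel_add_cancel_lt (x := z⁻¹) (hU.inv_mem z hz) hy hx (by simpa using hzy) hyx
    rw [inv_inv, cancel_comm z, cancel_comm y⁻¹ x] at h3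
    rw [cancel_comm y⁻¹, h1] at h2
    rw [List.prod_cons, cancel_comm _ z, cancel_comm y z]
    refine overlap_eq_of_lt hT (u := z o) (v := y o) ?_
    change cancel hT o z y < cancel hT o y (y * (x * l.prod))
    rw [cancel_comm z, cancel_comm y (y * _)]
    omega

/-- Prepending `y` cancels at most half of the next letter `x`. By induction the remaining product
is at least as long as `x`, so the loss is made up. -/
theorem len_le_len_prod {l : List (T ≃g T)} : ∀ {y : T ≃g T}, ReducedWord U (y :: l) →
    len o y ≤ len o (y * l.prod) := by
  induction l with
  | nil => intros; simp
  | cons x l ih =>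
    intro y hw
    have hy : y ∈ U := hw.mem y (by simp)
    have hx : x ∈ U := hw.mem x (by simp)
    have hyx : y ≠ x⁻¹ := (List.isChain_cons_cons.1 hw.chain).1
    have h1 := hU.cancel_prod hw.tail (hU.inv_mem y hy) (fun h => hyx (by rw [← h, inv_inv]))
    have h2 := hU.cancel_le_right y hy x hx hyx
    have h3 := ih hw.tail
    have h4 := len_mul (hT := hT) (o := o) y (x * l.prod)
    rw [cancel_comm, h1, cancel_comm] at h4
    rw [List.prod_cons]
    omega

theorem prod_ne_one {l : List (T ≃g T)} (hl : ReducedWord U l) (hne : l ≠ []) : l.prod ≠ 1 := by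
  cases l with
  | nil => exact absurd rfl hne
  | cons y l =>
    intro h
    have h1 := hU.len_le_len_prod hl
    have h2 := hU.len_pos y (hl.mem y (by simp))
    rw [← List.prod_cons, h] at h1
    have h3 : len o (1 : T ≃g T) = 0 := dist_self
    omega

theorem prod_starLT_cons {y x : T ≃g T} {l : List (T ≃g T)} (hw : ReducedWord U (y :: x :: l)) :
    R.StarLT (x :: l).prod (y :: x :: l).prod := by
  have hy : y ∈ U := hw.mem y (by simp)
  have hx : x ∈ U := hw.mem x (by simp)
  have hyx : y ≠ x⁻¹ := (List.isChain_cons_cons.1 hw.chain).1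
  have hxy : x⁻¹ ≠ y⁻¹⁻¹ := by rw [inv_inv]; exact hyx.symm
  have h1 := hU.cancel_prod hw.tail (hU.inv_mem y hy) (fun h => hyx (by rw [← h, inv_inv]))
  have h2 := hU.len_le_len_prod hw.tail
  have h3 := hU.cancel_le_right x⁻¹ (hU.inv_mem x hx) y⁻¹ (hU.inv_mem y hy) hxy
  have h4 := hU.cancel_le_left (hU.inv_mem x hx) (hU.inv_mem y hy) hxy
  have h5 := hU.half_lt x⁻¹ (hU.inv_mem x hx) y⁻¹ (hU.inv_mem y hy) hxy
  rw [inv_inv, len_inv hT] at *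
  -- Passing to inverses turns prepending `y` into right multiplication by `y⁻¹`, the form that the
  -- criterion handles.
  have := R.starLT_mul (g := (x * l.prod)⁻¹) (h := y⁻¹)
    (by rw [inv_inv, h1, len_inv hT]; omega) (by rw [inv_inv, h1, len_inv hT]; omega)
    (by rw [inv_inv, h1, len_inv hT, inv_inv]; exact h5)
  rwa [← mul_inv_rev, R.starLT_inv_left, R.starLT_inv_right] at this

theorem last_starLT_prod {l : List (T ≃g T)} (hl : l ≠ []) : ∀ {z : T ≃g T},
    ReducedWord U (l ++ [z]) → R.StarLT z (l ++ [z]).prod := by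
  induction l with
  | nil => exact absurd rfl hl
  | cons y l ih =>
    intro z hw
    cases l with
    | nil => simpa using hU.prod_starLT_cons hw
    | cons x l => exact R.starLT_trans (ih (by simp) hw.tail) (hU.prod_starLT_cons hw)

theorem head_starLT_prod {y x : T ≃g T} {l : List (T ≃g T)} (hw : ReducedWord U (y :: x :: l)) :
    R.StarLT y (y :: x :: l).prod := by
  have h1 := hw.inv_reverse hU.inv_mem
  rw [List.map_cons, List.reverse_cons] at h1
  have h2 := hU.last_starLT_prod (by simp) h1
  rwa [← List.reverse_cons, ← List.map_cons, ← List.prod_inv_reverse, R.starLT_inv_left,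
    R.starLT_inv_right] at h2

/-- Suffixes increase strictly in `<⋆` as letters are prepended; the first letter is covered by
reversing and inverting the word. -/
theorem mem_starLT_prod {l : List (T ≃g T)} : ReducedWord U l → 2 ≤ l.length → ∀ z ∈ l,
    R.StarLT z l.prod := by
  induction l with
  | nil => simp
  | cons y l ih =>
    intro hw hlen z hz
    cases l with
    | nil => simp at hlen
    | cons x l =>
      rcases List.mem_cons.1 hz with rfl | hz
      · exact hU.head_starLT_prod hw
      · have h1 := hU.prod_starLT_cons hw
        cases l with
        | nil => simp_all
        | cons x' l => exact R.starLT_trans (ih hw.tail (by simp) z hz) h1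

/-! ### Uniqueness and freeness of reduced bases -/

omit hU

/-- A strongly N-reduced basis is determined, up to inversion, by the group. -/
theorem symmetrize_eq {S : Set (T ≃g T)} (hU : CancelReduced R (symmetrize S)) :
    symmetrize S = {g | g ∈ Subgroup.closure S ∧
      g ∉ Subgroup.closure {h | h ∈ Subgroup.closure S ∧ R.StarLT h g}} := by
  ext g
  constructor
  · intro hg
    refine ⟨symmetrize_subset_closure hg, fun hmem => ?_⟩
    -- A reduced word for an element below `g` cannot contain `g` or `g⁻¹`, since no letter exceeds
    -- the product.
    have hle : Subgroup.closure {h | h ∈ Subgroup.closure S ∧ R.StarLT h g} ≤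
        Subgroup.closure {s | s ∈ S ∧ s ≠ g ∧ s ≠ g⁻¹} := by
      rw [Subgroup.closure_le]
      rintro h ⟨hS, hlt⟩
      obtain ⟨l, hl, rfl⟩ := exists_reducedWord hS
      refine Subgroup.list_prod_mem _ fun x hx => ?_
      have hxg : ¬ (x = g ∨ x = g⁻¹) := by
        intro hxg
        have hlt' : R.StarLT l.prod x := by
          rcases hxg with rfl | rfl
          exacts [hlt, R.starLT_inv_right.2 hlt]
        by_cases h2 : 2 ≤ l.length
        · exact R.starLT_asymm hlt' (hU.mem_starLT_prod hl h2 x hx)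
        · have h1 := List.length_pos_of_mem hx
          obtain ⟨y, rfl⟩ := List.length_eq_one_iff.1 (show l.length = 1 by omega)
          rw [List.mem_singleton.1 hx, List.prod_singleton] at hlt'
          exact R.starLT_irrefl _ hlt'
      push Not at hxg
      rcases hl.mem x hx with h | h
      · exact Subgroup.subset_closure ⟨h, hxg⟩
      · rw [← inv_inv x]
        exact InvMemClass.inv_mem (Subgroup.subset_closure
          (show x⁻¹ ∈ {s | s ∈ S ∧ s ≠ g ∧ s ≠ g⁻¹} from
            ⟨h, fun e => hxg.2 (by rw [← e, inv_inv]), fun e => hxg.1 (inv_inj.1 e)⟩))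
    obtain ⟨l, hl, hprod⟩ := exists_reducedWord (hle hmem)
    -- If `g` were a word in the other letters, prepending `g⁻¹` would give a nonempty reduced word
    -- with product `1`.
    have hl' : ReducedWord (symmetrize S) (g⁻¹ :: l) := by
      refine ⟨?_, ?_⟩
      · rintro x (_ | ⟨_, hx⟩)
        · exact inv_mem_symmetrize hg
        · exact (hl.mem x hx).imp And.left And.left
      · cases l with
        | nil => simp
        | cons x l =>
          refine List.isChain_cons_cons.2 ⟨fun e => ?_, hl.chain⟩
          have := inv_inj.1 e
          rcases hl.mem x (by simp) with h | h
          · exact h.2.1 this.symm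
          · exact h.2.2 (by rw [this])
    exact hU.prod_ne_one hl' (by simp) (by simp [hprod])
  -- A word of length at least two is a product of smaller elements and the empty word is `1`, so
  -- only single letters remain.
  · rintro ⟨hg, hnot⟩
    obtain ⟨l, hl, rfl⟩ := exists_reducedWord hg
    by_cases h2 : 2 ≤ l.length
    · exact absurd (Subgroup.list_prod_mem _ fun x hx => Subgroup.subset_closure
        (show _ ∧ _ from
          ⟨symmetrize_subset_closure (hl.mem x hx), hU.mem_starLT_prod hl h2 x hx⟩)) hnot
    · rcases l with _ | ⟨x, _ | ⟨y, l⟩⟩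
      · exact absurd (one_mem _) hnot
      · simpa using hl.mem x (by simp)
      · exact absurd (by simp) h2

/-- A reduced word of the free group becomes a `ReducedWord`: opposite signs on one generator are
excluded by reducedness, and equal signs by `S ∩ S⁻¹ = ∅`. -/
theorem isFreeBasis {S : Set (T ≃g T)} (hU : CancelReduced R (symmetrize S))
    (hS : ∀ x ∈ S, x⁻¹ ∉ S) : IsFreeBasis S (Subgroup.closure S) := by
  classical
  refine ⟨(injective_iff_map_eq_one _).2 fun w hw => ?_, rfl⟩
  by_contra hne
  rw [← FreeGroup.mk_toWord (x := w), FreeGroup.lift_mk] at hw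
  refine hU.prod_ne_one ⟨?_, ?_⟩ ?_ hw
  · intro x hx
    obtain ⟨⟨y, b⟩, -, rfl⟩ := List.mem_map.1 hx
    cases b
    · exact inv_mem_symmetrize (.inl y.2)
    · exact .inl y.2
  · rw [List.isChain_map]
    have hred := FreeGroup.isReduced_toWord (x := w)
    rw [FreeGroup.IsReduced] at hred
    refine hred.imp ?_
    rintro ⟨⟨x, hx⟩, b⟩ ⟨⟨y, hy⟩, c⟩ h e
    cases b <;> cases c <;> simp at e h
    · exact hS y hy (by rw [← e, inv_inv] at *; exact hx)
    · exact h e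
    · exact h e
    · exact hS y hy (e ▸ hx)
  · simpa using hne

theorem stronglyNReduced {S : Set (T ≃g T)} (hU : CancelReduced R (symmetrize S))
    (hS : ∀ x ∈ S, x⁻¹ ∉ S) : StronglyNReduced R S (Subgroup.closure S) :=
  ⟨hU.isFreeBasis hS, hS, fun x hx y hy hxy => R.starLT_mul (hU.cancel_le_left hx hy hxy)
    (hU.cancel_le_right x hx y hy hxy) (hU.half_lt x hx y hy hxy)⟩

end CancelReduced

end Words

/-! ### Nielsen moves and irreducible families -/

section Reduction

variable {V : Type*} {T : SimpleGraph V} {hT : T.IsTree} {o : V} {R : PathOrder hT o}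

theorem Hyperbolic.len_pos (hT : T.IsTree) (o : V) {g : T ≃g T} (hg : Hyperbolic g) :
    0 < len o g :=
  (Nat.zero_le _).trans_lt (hg.two_mul_cancel_lt (hT := hT))

theorem Hyperbolic.initialHalf_ne {g : T ≃g T} (hg : Hyperbolic g) {k : ℕ}
    (hk : len o g = 2 * k) : initialHalf hT o g ≠ initialHalf hT o g⁻¹ :=
  fun h => not_hyperbolic_of_fixed_vertex (apply_initialHalf_of_even hk h) hg

/-- The order condition on products gives the half bound by comparing lengths. At a tie, `H(y⁻¹) <
H(y)` would make `x * y` smaller than `x`, and equal halves would make `y` fix a vertex. -/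
theorem StronglyNReduced.cancelReduced {S : Set (T ≃g T)} {G : Subgroup (T ≃g T)}
    (hS : StronglyNReduced R S G) (hG : PurelyHyperbolic G) :
    CancelReduced R (symmetrize S) := by
  have hyp : ∀ x ∈ symmetrize S, Hyperbolic x := fun x hx => by
    refine hG x (hS.freeBasis.2 ▸ symmetrize_subset_closure hx) ?_
    rintro rfl
    have h1 : (1 : T ≃g T) ∈ S := by simpa [symmetrize] using hx
    exact hS.n1 1 h1 (by simpa using h1)
  have hle : ∀ x ∈ symmetrize S, ∀ y ∈ symmetrize S, x ≠ y⁻¹ →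
      2 * cancel hT o x⁻¹ y ≤ len o y := fun x hx y hy hxy => by
    have h1 := len_mul (hT := hT) (o := o) x y
    rcases hS.n4 x hx y hy hxy with h | ⟨h, -⟩ <;> omega
  refine ⟨fun x => inv_mem_symmetrize, fun x hx => (hyp x hx).len_pos hT o, hle, ?_⟩
  intro x hx y hy hxy heq
  have h1 := len_mul (hT := hT) (o := o) x y
  have h2 := hle y⁻¹ (inv_mem_symmetrize hy) x⁻¹ (inv_mem_symmetrize hx)
    (by rw [inv_inv]; exact hxy.symm)
  rw [inv_inv, cancel_comm, len_inv hT] at h2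
  rcases R.pathLT_trichotomy (initialHalf hT o y) (initialHalf hT o y⁻¹) with h | h | h
  · exact h
  · exact absurd h ((hyp y hy).initialHalf_ne heq.symm)
  · exact absurd (R.mul_starLT (g := x) (h := y) (by omega) (by omega) h)
      (R.starLT_asymm (hS.n4 x hx y hy hxy))

/-- The condition under which the algorithm replaces `x` by `x * y`. -/
def Reducible (R : PathOrder hT o) (x y : T ≃g T) : Prop :=
  len o (x * y) < len o x ∨ (len o (x * y) = len o x ∧ len o y ≤ len o x ∧
    R.PathLT (initialHalf hT o y⁻¹) (initialHalf hT o y))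

theorem Reducible.starLT {x y : T ≃g T} (h : Reducible R x y) : R.StarLT (x * y) x := by
  rcases h with h | ⟨h1, h2, h3⟩
  · exact .inl h
  · exact R.mul_starLT h1 h2 h3

/-- The members of a finite family, followed by their inverses. -/
def letter {A : Type*} [Group A] (x : ℕ → A) (n k : ℕ) : A :=
  if k < n then x k else (x (k - n))⁻¹

/-- The index of the member of the family that a letter comes from. -/
def letterIndex (n k : ℕ) : ℕ :=
  if k < n then k else k - n

theorem letterIndex_lt {n k : ℕ} (hk : k < 2 * n) : letterIndex n k < n := by
  unfold letterIndex; split_ifs <;> omega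

theorem letter_mem {A : Type*} [Group A] {x : ℕ → A} {n k : ℕ} {G : Subgroup A}
    (hx : ∀ i < n, x i ∈ G) (hk : k < 2 * n) : letter x n k ∈ G := by
  unfold letter; split_ifs
  · exact hx _ ‹_›
  · exact inv_mem (hx _ (by omega))

theorem letter_eq_or {A : Type*} [Group A] (x : ℕ → A) (n k : ℕ) :
    letter x n k = x (letterIndex n k) ∨ letter x n k = (x (letterIndex n k))⁻¹ := by
  unfold letter letterIndex; split_ifs <;> simp

theorem exists_letter {A : Type*} [Group A] {x : ℕ → A} {n : ℕ} {g : A}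
    (hg : g ∈ symmetrize {g | ∃ i < n, x i = g ∧ g ≠ 1}) :
    ∃ k < 2 * n, letter x n k = g ∧ g ≠ 1 := by
  rcases hg with ⟨i, hi, rfl, h1⟩ | ⟨i, hi, h, h1⟩
  · exact ⟨i, by omega, by simp [letter, hi], h1⟩
  · exact ⟨i + n, by omega, by simp [letter, h], by simpa using h1⟩

theorem cancelReduced_of_not_reducible {G : Subgroup (T ≃g T)} (hG : PurelyHyperbolic G)
    {x : ℕ → T ≃g T} {n : ℕ} (hx : ∀ i < n, x i ∈ G)
    (h : ∀ i < 2 * n, ∀ j < 2 * n, letterIndex n i ≠ letterIndex n j →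
      ¬ Reducible R (letter x n i) (letter x n j)) :
    CancelReduced R (symmetrize {g | ∃ i < n, x i = g ∧ g ≠ 1}) := by
  set U := symmetrize {g | ∃ i < n, x i = g ∧ g ≠ 1} with hU
  have hyp : ∀ g ∈ U, Hyperbolic g := fun g hg => by
    obtain ⟨k, hk, rfl, h1⟩ := exists_letter hg
    exact hG _ (letter_mem hx hk) h1
  -- Letters with the same index are equal or inverse. The search skips such pairs, and
  -- hyperbolicity controls the products `g * g`.
  have key : ∀ g ∈ U, ∀ g' ∈ U, g ≠ g'⁻¹ → g = g' ∨ ¬ Reducible R g g' := by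
    intro g hg g' hg' hne
    obtain ⟨k, hk, rfl, -⟩ := exists_letter hg
    obtain ⟨k', hk', rfl, -⟩ := exists_letter hg'
    by_cases he : letterIndex n k = letterIndex n k'
    · left
      have h1 := letter_eq_or x n k
      have h2 := letter_eq_or x n k'
      rw [he] at h1
      rcases h1 with h1 | h1 <;> rcases h2 with h2 | h2
      · rw [h1, h2]
      · exact absurd (by rw [h1, h2, inv_inv]) hne
      · exact absurd (by rw [h1, h2]) hne
      · rw [h1, h2]
    · exact .inr (h k hk k' hk' he)
  have hle : ∀ g ∈ U, ∀ g' ∈ U, g ≠ g'⁻¹ → 2 * cancel hT o g⁻¹ g' ≤ len o g' := by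
    intro g hg g' hg' hne
    rcases key g hg g' hg' hne with rfl | hred
    · exact ((hyp g hg).two_mul_cancel_lt).le
    · have h1 := len_mul (hT := hT) (o := o) g g'
      have h2 : ¬ len o (g * g') < len o g := fun h2 => hred (.inl h2)
      omega
  refine ⟨fun g => inv_mem_symmetrize, fun g hg => (hyp g hg).len_pos hT o, hle, ?_⟩
  intro g hg g' hg' hne heq
  have h1 := hle g'⁻¹ (inv_mem_symmetrize hg') g⁻¹ (inv_mem_symmetrize hg)
    (by rw [inv_inv]; exact hne.symm)
  rw [inv_inv, cancel_comm, len_inv hT] at h1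
  rcases key g hg g' hg' hne with rfl | hred
  · exact absurd heq ((hyp g hg).two_mul_cancel_lt).ne
  rcases R.pathLT_trichotomy (initialHalf hT o g') (initialHalf hT o g'⁻¹) with h2 | h2 | h2
  · exact h2
  · exact absurd h2 ((hyp g' hg').initialHalf_ne heq.symm)
  · have h3 := len_mul (hT := hT) (o := o) g g'
    exact absurd (.inr ⟨by omega, by omega, h2⟩) hred

/-- Inverse entries at different indices would have a trivial, hence shorter, product. A nontrivial
entry equal to its own inverse would cancel completely against itself. -/
theorem inv_notMem_of_not_reducible {G : Subgroup (T ≃g T)} (hG : PurelyHyperbolic G)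
    {x : ℕ → T ≃g T} {n : ℕ} (hx : ∀ i < n, x i ∈ G)
    (h : ∀ i < 2 * n, ∀ j < 2 * n, letterIndex n i ≠ letterIndex n j →
      ¬ Reducible R (letter x n i) (letter x n j)) :
    ∀ g ∈ {g | ∃ i < n, x i = g ∧ g ≠ 1}, g⁻¹ ∉ {g | ∃ i < n, x i = g ∧ g ≠ 1} := by
  rintro _ ⟨i, hi, rfl, h1⟩ ⟨j, hj, hji, -⟩
  have hyp := hG _ (hx i hi) h1
  have h0 : len o (1 : T ≃g T) = 0 := dist_self
  by_cases hij : i = j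
  · subst hij
    have h2 := len_mul (hT := hT) (o := o) (x i) (x i)
    have h3 := hyp.two_mul_cancel_lt (hT := hT) (o := o)
    have h4 : x i * x i = 1 := by nth_rw 2 [hji]; simp
    rw [h4, h0] at h2
    omega
  · refine h i (by omega) j (by omega) (by simp [letterIndex, hi, hj, hij]) (.inl ?_)
    simp only [letter, hi, hj, if_true, hji, mul_inv_cancel, h0]
    exact hyp.len_pos hT o

/-- The move is invertible: its two letters come from different entries, so the second is still
available to undo the multiplication. -/
theorem closure_letter_step {A : Type*} [Group A] {x y : ℕ → A} {n i j : ℕ}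
    (hi : i < 2 * n) (hj : j < 2 * n) (hij : letterIndex n i ≠ letterIndex n j)
    (hy : y (letterIndex n i) = letter x n i * letter x n j)
    (hyx : ∀ k < n, k ≠ letterIndex n i → y k = x k) :
    Subgroup.closure {g | ∃ k < n, y k = g} = Subgroup.closure {g | ∃ k < n, x k = g} := by
  have hmem : ∀ (z : ℕ → A) k, k < n → z k ∈ Subgroup.closure {g | ∃ k < n, z k = g} :=
    fun z k hk => Subgroup.subset_closure ⟨k, hk, rfl⟩
  apply le_antisymm <;> rw [Subgroup.closure_le] <;> rintro _ ⟨k, hk, rfl⟩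
  · by_cases hki : k = letterIndex n i
    · rw [hki, hy]
      exact mul_mem (letter_mem (hmem x) hi) (letter_mem (hmem x) hj)
    · rw [hyx k hk hki]
      exact hmem x k hk
  · by_cases hki : k = letterIndex n i
    · have h1 := hmem y _ (letterIndex_lt hi)
      have h2 : letter x n j ∈ Subgroup.closure {g | ∃ k < n, y k = g} := by
        have h3 := hmem y _ (letterIndex_lt hj)
        rw [hyx _ (letterIndex_lt hj) hij.symm] at h3
        rcases letter_eq_or x n j with h4 | h4 <;> rw [h4]
        exacts [h3, inv_mem h3]
      rw [hy, Subgroup.mul_mem_cancel_right _ h2] at h1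
      rw [hki]
      rcases letter_eq_or x n i with h4 | h4 <;> rw [h4] at h1
      exacts [h1, inv_mem_iff.1 h1]
    · rw [← hyx k hk hki]
      exact hmem y k hk

end Reduction

section Hoare

variable {V : Type*} {T : SimpleGraph V} {hT : T.IsTree} {o : V} (R : PathOrder hT o)

/-! ### Total correctness of programs -/

/-- The program `P`, started with memory `m`, halts with a memory that satisfies `Q`. -/
def Runs (P : Program) (m : Memory T) (Q : Memory T → Prop) : Prop :=
  ∃ m', Exec R P m m' ∧ Q m'

/-- Sequential composition of a list of programs. -/
def Program.block : List Program → Program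
  | [] => .skip
  | P :: L => .seq P (block L)

/-- The contents of a number register with a fixed address. -/
def NatExp.var (k : ℕ) : NatExp :=
  .reg (.const k)

/-- Assignment to a number register with a fixed address. -/
def Program.assign (k : ℕ) (e : NatExp) : Program :=
  .setNat (.const k) e

/-- Disjunction of tests. -/
def Test.or (b c : Test) : Test :=
  .not (.and (.not b) (.not c))

@[simp]
theorem NatExp.eval_var (k : ℕ) (m : Memory T) : (NatExp.var k).eval m = m.nat k := rfl

@[simp]
theorem Test.holds_or (b c : Test) (m : Memory T) :
    (Test.or b c).Holds R m ↔ b.Holds R m ∨ c.Holds R m := by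
  simp only [Test.or, Test.Holds]
  tauto

variable {R}

namespace Runs

variable {P P' : Program} {L : List Program} {m : Memory T} {Q Q' : Memory T → Prop}

theorem mono (h : Runs R P m Q) (hQ : ∀ m', Q m' → Q' m') : Runs R P m Q' := by
  obtain ⟨m', h1, h2⟩ := h
  exact ⟨m', h1, hQ m' h2⟩

theorem skip (h : Q m) : Runs R .skip m Q :=
  ⟨m, .skip m, h⟩

theorem nil (h : Q m) : Runs R (.block []) m Q :=
  skip h

theorem cons (h : Runs R P m fun m' => Runs R (.block L) m' Q) :
    Runs R (.block (P :: L)) m Q := by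
  obtain ⟨m₁, h1, m₂, h2, h3⟩ := h
  exact ⟨m₂, .seq _ _ _ _ _ h1 h2, h3⟩

theorem assign {k : ℕ} {e : NatExp}
    (h : Q ⟨Function.update m.nat k (e.eval m), m.vtx, m.aut⟩) : Runs R (.assign k e) m Q :=
  ⟨_, .setNat _ _ _, h⟩

theorem setDist {k : ℕ} {u w : VtxExp}
    (h : Q ⟨Function.update m.nat k (T.dist (u.eval hT o m) (w.eval hT o m)), m.vtx, m.aut⟩) :
    Runs R (.setDist (.const k) u w) m Q :=
  ⟨_, .setDist _ _ _ _, h⟩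

theorem setAut {i : NatExp} {g : AutExp}
    (h : Q ⟨m.nat, m.vtx, Function.update m.aut (i.eval m) (g.eval m)⟩) :
    Runs R (.setAut i g) m Q :=
  ⟨_, .setAut _ _ _, h⟩

theorem ite {b : Test} (h : b.Holds R m → Runs R P m Q) (h' : ¬ b.Holds R m → Runs R P' m Q) :
    Runs R (.ite b P P') m Q := by
  by_cases hb : b.Holds R m
  · obtain ⟨m', h1, h2⟩ := h hb
    exact ⟨m', .iteTrue _ _ _ _ _ hb h1, h2⟩
  · obtain ⟨m', h1, h2⟩ := h' hb
    exact ⟨m', .iteFalse _ _ _ _ _ hb h1, h2⟩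

/-- The variant takes values in an arbitrary well-founded relation, since `<⋆`-descent has no
numerical bound in general. -/
theorem loop {α : Type*} {r : α → α → Prop} (hr : WellFounded r) (μ : Memory T → α)
    (I : Memory T → Prop) {b : Test}
    (step : ∀ m, I m → b.Holds R m → Runs R P m fun m' => I m' ∧ r (μ m') (μ m)) (hm : I m) :
    Runs R (.loop b P) m fun m' => I m' ∧ ¬ b.Holds R m' := by
  induction h : μ m using hr.induction generalizing m with
  | _ a ih =>
    subst h
    by_cases hb : b.Holds R m
    · obtain ⟨m₁, h1, h2, h3⟩ := step m hm hb
      obtain ⟨m₂, h4, h5⟩ := ih _ h3 h2 rfl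
      exact ⟨m₂, .loopStep _ _ _ _ _ hb h1 h4, h5⟩
    · exact ⟨m, .loopDone _ _ _ hb, hm, hb⟩

end Runs

/-! ### Reduction of a segment -/

/-- Load the letter with the index in register `src`, of the segment of length `11` that starts at
address `10`, into the automorphism register `addr`, and its letter index into `dst`. -/
def loadLetter (src dst : ℕ) (addr : NatExp) : Program :=
  .ite (.natLT (.var src) (.var 11))
    (.block [.setAut addr (.reg (.add (.var 10) (.var src))), .assign dst (.var src)])
    (.block [.setAut addr (.inv (.reg (.add (.var 10) (.sub (.var src) (.var 11))))),
      .assign dst (.sub (.var src) (.var 11))])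

theorem runs_loadLetter {src dst : ℕ} {addr : NatExp} {m : Memory T} {Q : Memory T → Prop}
    (h : Q ⟨Function.update m.nat dst (letterIndex (m.nat 11) (m.nat src)), m.vtx,
      Function.update m.aut (addr.eval m)
        (letter (fun i => m.aut (m.nat 10 + i)) (m.nat 11) (m.nat src))⟩) :
    Runs R (loadLetter src dst addr) m Q := by
  refine Runs.ite (fun hb => ?_) (fun hb => ?_)
  all_goals
    simp only [Test.Holds, NatExp.eval_var] at hb
    refine .cons (.setAut (.cons (.assign (.nil ?_))))
    simpa [letter, letterIndex, hb, NatExp.eval, AutExp.eval] using h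

/-- The test for `Reducible`, for automorphisms in the registers `a` and `b`, when the registers
`18`, `19` and `20` hold the lengths of the product and of the factors. -/
def reducibleTest (b : AutExp) : Test :=
  .or (.natLT (.var 18) (.var 19))
    (.and (.natEq (.var 18) (.var 19)) (.and (.not (.natLT (.var 19) (.var 20)))
      (.pathLT (.along .base (.act (.inv b) .base) (.div (.var 20) (.const 2)))
        (.along .base (.act b .base) (.div (.var 20) (.const 2))))))

theorem holds_reducibleTest {b : AutExp} {m : Memory T} {x y : T ≃g T} (hb : b.eval m = y)
    (h18 : m.nat 18 = len o (x * y)) (h19 : m.nat 19 = len o x) (h20 : m.nat 20 = len o y) :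
    (reducibleTest b).Holds R m ↔ Reducible R x y := by
  simp [reducibleTest, Test.Holds, VtxExp.eval, AutExp.eval, NatExp.eval, Reducible, h18, h19, h20,
    hb, initialHalf, len_inv hT]

/-- One round: inspect the pair of letters whose code is in register `13`, and replace the first
one if the pair is reducible. -/
def reduceStep : Program :=
  .block [
    .assign 14 (.div (.var 13) (.mul (.const 2) (.var 11))),
    .assign 15 (.sub (.var 13) (.mul (.mul (.const 2) (.var 11)) (.var 14))),
    loadLetter 14 16 (.var 12),
    loadLetter 15 17 (.add (.var 12) (.const 1)),
    .setDist (.const 18) .base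
      (.act (.mul (.reg (.var 12)) (.reg (.add (.var 12) (.const 1)))) .base),
    .setDist (.const 19) .base (.act (.reg (.var 12)) .base),
    .setDist (.const 20) .base (.act (.reg (.add (.var 12) (.const 1))) .base),
    .ite (.and (.not (.natEq (.var 16) (.var 17)))
        (reducibleTest (.reg (.add (.var 12) (.const 1)))))
      (.block [
        .setAut (.add (.var 10) (.var 16))
          (.mul (.reg (.var 12)) (.reg (.add (.var 12) (.const 1)))),
        .assign 13 (.const 0)])
      (.assign 13 (.add (.var 13) (.const 1)))]

theorem letter_congr {A : Type*} [Group A] {x y : ℕ → A} {n k : ℕ} (h : ∀ i < n, x i = y i)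
    (hk : k < 2 * n) : letter x n k = letter y n k := by
  unfold letter
  split_ifs
  · exact h _ ‹_›
  · rw [h _ (by omega)]

/-- Letters `i` and `j` of the segment `x` of length `n` can be used to reduce it. -/
def ReduciblePair (R : PathOrder hT o) (x : ℕ → T ≃g T) (n i j : ℕ) : Prop :=
  letterIndex n i ≠ letterIndex n j ∧ Reducible R (letter x n i) (letter x n j)

theorem reduciblePair_congr {x y : ℕ → T ≃g T} {n i j : ℕ} (h : ∀ k < n, x k = y k)
    (hi : i < 2 * n) (hj : j < 2 * n) : ReduciblePair R x n i j ↔ ReduciblePair R y n i j := by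
  rw [ReduciblePair, ReduciblePair, letter_congr h hi, letter_congr h hj]

theorem runs_reduceStep {m : Memory T} {Q : Memory T → Prop} {b n c t i j : ℕ}
    (hb : m.nat 10 = b) (hn : m.nat 11 = n) (hc : m.nat 12 = c) (ht : m.nat 13 = t)
    (hbc : b + n ≤ c) (hi : t / (2 * n) = i) (hj : t - 2 * n * i = j) (hj' : j < 2 * n)
    (h : ∀ m', (∀ k ≤ 12, m'.nat k = m.nat k) →
      (∀ k < c, k ≠ b + letterIndex n i → m'.aut k = m.aut k) →
      (ReduciblePair R (fun k => m.aut (b + k)) n i j → m'.nat 13 = 0 ∧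
        m'.aut (b + letterIndex n i) =
          letter (fun k => m.aut (b + k)) n i * letter (fun k => m.aut (b + k)) n j) →
      (¬ ReduciblePair R (fun k => m.aut (b + k)) n i j → m'.nat 13 = t + 1 ∧
        ∀ k < c, m'.aut k = m.aut k) → Q m') :
    Runs R reduceStep m Q := by
  set x := letter (fun k => m.aut (b + k)) n i with hx
  set y := letter (fun k => m.aut (b + k)) n j with hy
  -- Storing the first letter in register `c` does not disturb the second, because the segment ends
  -- before `c`.
  have hy' : letter (fun k => if b + k = c then x else m.aut (b + k)) n j = y :=
    letter_congr (fun k hk => if_neg (by omega)) hj'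
  refine .cons (.assign (.cons (.assign (.cons (runs_loadLetter (.cons (runs_loadLetter
    (.cons (.setDist (.cons (.setDist (.cons (.setDist ?_)))))))))))))
  simp only [NatExp.eval, NatExp.eval_var, Function.update_apply, hb, hn, hc, ht, hi, hj,
    VtxExp.eval, AutExp.eval, Nat.reduceEqDiff, ← hx, hy', ↓reduceIte,
    (show c ≠ c + 1 by omega)]
  set m₁ : Memory T := ⟨_, _, _⟩ with hm₁
  have e1 : ∀ k ≤ 13, m₁.nat k = m.nat k := fun k hk => by
    simp only [m₁, Function.update_apply]
    repeat rw [if_neg (by omega)]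
  have e2 : m₁.nat 16 = letterIndex n i ∧ m₁.nat 17 = letterIndex n j ∧
      m₁.nat 18 = len o (x * y) ∧ m₁.nat 19 = len o x ∧ m₁.nat 20 = len o y := by
    simp [m₁, len]
  have e3 : m₁.aut c = x ∧ m₁.aut (c + 1) = y := by
    simp [m₁]
  have e4 : ∀ k < c, m₁.aut k = m.aut k := fun k hk => by
    simp only [m₁, Function.update_apply]
    repeat rw [if_neg (by omega)]
  clear_value m₁
  obtain ⟨h16, h17, h18, h19, h20⟩ := e2
  obtain ⟨hx₁, hy₁⟩ := e3
  have hy₂ : (AutExp.reg ((NatExp.var 12).add (NatExp.const 1))).eval m₁ = y := by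
    simp [AutExp.eval, NatExp.eval, e1, hc, hy₁]
  have htest : ((Test.natEq (.var 16) (.var 17)).not.and
      (reducibleTest (.reg (.add (.var 12) (.const 1))))).Holds R m₁ ↔
      ReduciblePair R (fun k => m.aut (b + k)) n i j := by
    simp only [Test.Holds, NatExp.eval_var, h16, h17, holds_reducibleTest hy₂ h18 h19 h20]
    rfl
  have hxy₁ : (AutExp.mul (.reg (.var 12)) (.reg (.add (.var 12) (.const 1)))).eval m₁ =
      x * y := by
    rw [AutExp.eval, hy₂]
    simp [AutExp.eval, e1, hc, hx₁]
  refine .cons (.ite (fun hr => ?_) (fun hr => ?_)) <;> rw [htest] at hr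
  · refine .cons (.setAut (.cons (.assign (.nil (.nil (h _ ?_ ?_ (fun _ => ⟨?_, ?_⟩)
      (fun hn => absurd hr hn)))))))
    · intro k hk
      simp [e1 k (by omega), (show k ≠ 13 by omega)]
    · intro k hk hk'
      simp [NatExp.eval, e1, hb, h16, hk', e4 k hk]
    · simp [NatExp.eval]
    · simp [Function.update_apply, NatExp.eval, e1, hb, h16, hxy₁]
  · refine .assign (.nil (h _ ?_ (fun k hk _ => e4 k hk) (fun hn => absurd hn hr)
      (fun _ => ⟨?_, e4⟩)))
    · intro k hk
      simp [e1 k (by omega), (show k ≠ 13 by omega)]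
    · simp [NatExp.eval, e1, ht]

/-- Reduce the segment of length `11` that starts at address `10`, using the automorphism registers
`12` and its successor. -/
def reduceLoop : Program :=
  .loop (.natLT (.var 13) (.mul (.mul (.const 2) (.var 11)) (.mul (.const 2) (.var 11)))) reduceStep

theorem runs_reduceLoop {G : Subgroup (T ≃g T)} {m : Memory T} {b n c : ℕ}
    (hb : m.nat 10 = b) (hn : m.nat 11 = n) (hc : m.nat 12 = c) (ht : m.nat 13 = 0)
    (hbc : b + n ≤ c) (hG : Subgroup.closure {g | ∃ k < n, m.aut (b + k) = g} = G) :
    Runs R reduceLoop m fun m' => (∀ k ≤ 12, m'.nat k = m.nat k) ∧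
      (∀ k < c, (k < b ∨ b + n ≤ k) → m'.aut k = m.aut k) ∧
      Subgroup.closure {g | ∃ k < n, m'.aut (b + k) = g} = G ∧
      ∀ i < 2 * n, ∀ j < 2 * n, ¬ ReduciblePair R (fun k => m'.aut (b + k)) n i j := by
  -- A move decreases the tuple of generators but resets the search counter; an unsuccessful
  -- inspection keeps the tuple and advances the counter. The variant is therefore lexicographic.
  have hwf : WellFounded (Prod.Lex
      (Pi.Lex (β := fun _ : Fin n => T ≃g T) (· < ·) (fun {_} => R.StarLT))
      ((· < ·) : ℕ → ℕ → Prop)) :=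
    WellFounded.prod_lex (Pi.Lex.wellFounded _ fun _ => R.wellFounded_starLT) Nat.lt_wfRel.wf
  refine (Runs.loop hwf
    (fun m' => (fun i => m'.aut (b + i), 2 * n * (2 * n) - m'.nat 13))
    (fun m' => (∀ k ≤ 12, m'.nat k = m.nat k) ∧
      (∀ k < c, (k < b ∨ b + n ≤ k) → m'.aut k = m.aut k) ∧
      Subgroup.closure {g | ∃ k < n, m'.aut (b + k) = g} = G ∧
      ∀ s < m'.nat 13, ¬ ReduciblePair R (fun k => m'.aut (b + k)) n (s / (2 * n))
        (s - 2 * n * (s / (2 * n)))) ?_ ⟨fun _ _ => rfl, fun _ _ _ => rfl, hG, ?_⟩).mono ?_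
  · rintro m₁ ⟨h1, h2, h3, h4⟩ hlt
    simp only [Test.Holds, NatExp.eval, NatExp.eval_var, h1 11 (by omega), hn] at hlt
    have hn0 : 0 < 2 * n := Nat.pos_of_ne_zero fun h => by simp [h] at hlt
    have hi : m₁.nat 13 / (2 * n) < 2 * n := Nat.div_lt_of_lt_mul hlt
    have hj : m₁.nat 13 - 2 * n * (m₁.nat 13 / (2 * n)) < 2 * n := by
      rw [← Nat.mod_eq_sub_mul_div]
      exact Nat.mod_lt _ hn0
    have hil := letterIndex_lt hi
    refine runs_reduceStep ((h1 10 (by omega)).trans hb) ((h1 11 (by omega)).trans hn)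
      ((h1 12 (by omega)).trans hc) rfl hbc rfl rfl hj fun m₂ k1 k2 k3 k4 => ?_
    by_cases hr : ReduciblePair R (fun k => m₁.aut (b + k)) n (m₁.nat 13 / (2 * n))
      (m₁.nat 13 - 2 * n * (m₁.nat 13 / (2 * n)))
    · obtain ⟨k5, k6⟩ := k3 hr
      refine ⟨⟨fun k hk => (k1 k hk).trans (h1 k hk), fun k hk hk' => ?_, ?_, ?_⟩, ?_⟩
      · rw [k2 k hk (by omega), h2 k hk hk']
      · rw [← h3]
        exact closure_letter_step (x := fun k => m₁.aut (b + k)) (y := fun k => m₂.aut (b + k))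
          hi hj hr.1 k6 (fun k hk hk' => k2 _ (by omega) (by omega))
      · simp [k5]
      · refine .left _ _ ⟨⟨_, hil⟩, fun k hk => ?_, ?_⟩
        · have : (k : ℕ) < letterIndex n (m₁.nat 13 / (2 * n)) := hk
          exact k2 _ (by omega) (by omega)
        · have hstar := hr.2.starLT
          simp only [k6]
          -- The replaced entry may be the inverse of the letter that was multiplied, which `<⋆`
          -- does not notice.
          rcases letter_eq_or (fun k => m₁.aut (b + k)) n (m₁.nat 13 / (2 * n)) with he | he
          · nth_rw 2 [he] at hstar
            exact hstar
          · nth_rw 2 [he] at hstar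
            exact R.starLT_inv_right.1 hstar
    · obtain ⟨k5, k6⟩ := k4 hr
      have hseg : ∀ k < n, m₂.aut (b + k) = m₁.aut (b + k) := fun k hk => k6 _ (by omega)
      refine ⟨⟨fun k hk => (k1 k hk).trans (h1 k hk), fun k hk hk' => ?_, ?_, ?_⟩, ?_⟩
      · rw [k6 k hk, h2 k hk hk']
      · rw [← h3]
        congr 1
        ext g
        exact exists_congr fun k => and_congr_right fun hk => by rw [hseg k hk]
      · intro s hs
        have hs' : s < 2 * n * (2 * n) := by omega
        rw [reduciblePair_congr hseg (Nat.div_lt_of_lt_mul hs')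
          (by rw [← Nat.mod_eq_sub_mul_div]; exact Nat.mod_lt _ hn0)]
        rcases (show s ≤ m₁.nat 13 by omega).lt_or_eq with h | rfl
        exacts [h4 s h, hr]
      · rw [Prod.lex_def]
        refine .inr ⟨funext fun k => hseg k k.2, ?_⟩
        simp only
        omega
  · simp [ht]
  · rintro m₁ ⟨⟨h1, h2, h3, h4⟩, h5⟩
    refine ⟨h1, h2, h3, fun i hi j hj => ?_⟩
    simp only [Test.Holds, NatExp.eval, NatExp.eval_var, h1 11 (by omega), hn] at h5
    -- The pair `(i, j)` has code `2n * i + j`, which is below `(2n)²` and so was inspected before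
    -- the loop ended.
    have hd : (2 * n * i + j) / (2 * n) = i := by
      rw [Nat.mul_add_div (by omega), Nat.div_eq_of_lt hj, add_zero]
    have hs : 2 * n * i + j < m₁.nat 13 := by
      have : 2 * n * (i + 1) ≤ 2 * n * (2 * n) := Nat.mul_le_mul_left _ hi
      rw [mul_add, mul_one] at this
      omega
    have := h4 _ hs
    rwa [hd, Nat.add_sub_cancel_left] at this

end Hoare

section Lists

variable {V : Type*} {T : SimpleGraph V} {hT : T.IsTree} {o : V} {R : PathOrder hT o}

/-! ### Removal of trivial elements -/

/-- Move the nontrivial automorphisms in the registers from `13` up to `14` to the registers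
from `15` on. -/
def compactLoop : Program :=
  .loop (.natLT (.var 13) (.var 14)) (.block [
    .ite (.autEq (.reg (.var 13)) .one) .skip (.block [
      .setAut (.var 15) (.reg (.var 13)),
      .assign 15 (.add (.var 15) (.const 1))]),
    .assign 13 (.add (.var 13) (.const 1))])

theorem runs_compactLoop {m : Memory T} {t c k : ℕ} (ht : m.nat 13 = t) (hc : m.nat 14 = c)
    (hk : m.nat 15 = k) (hkt : k ≤ t) (htc : t ≤ c) :
    Runs R compactLoop m fun m' => (∀ i, i ≠ 13 → i ≠ 15 → m'.nat i = m.nat i) ∧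
      m'.nat 13 = c ∧ k ≤ m'.nat 15 ∧ m'.nat 15 ≤ c ∧
      (∀ i, (i < k ∨ c ≤ i) → m'.aut i = m.aut i) ∧
      ∀ g, (∃ i, k ≤ i ∧ i < m'.nat 15 ∧ m'.aut i = g) ↔
        ∃ i, t ≤ i ∧ i < c ∧ m.aut i = g ∧ g ≠ 1 := by
  -- The write position never passes the read position, so unread registers still hold their
  -- original values.
  refine (Runs.loop (r := (· < ·)) Nat.lt_wfRel.wf (fun m' => c - m'.nat 13)
    (fun m' => (∀ i, i ≠ 13 → i ≠ 15 → m'.nat i = m.nat i) ∧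
      (t ≤ m'.nat 13 ∧ m'.nat 13 ≤ c) ∧ k ≤ m'.nat 15 ∧ m'.nat 15 ≤ m'.nat 13 ∧
      (∀ i, (i < k ∨ m'.nat 13 ≤ i) → m'.aut i = m.aut i) ∧
      ∀ g, (∃ i, k ≤ i ∧ i < m'.nat 15 ∧ m'.aut i = g) ↔
        ∃ i, t ≤ i ∧ i < m'.nat 13 ∧ m.aut i = g ∧ g ≠ 1) ?_
    ⟨fun _ _ _ => rfl, ⟨by omega, by omega⟩, by omega, by omega, fun _ _ => rfl, ?_⟩).mono ?_
  · rintro m₁ ⟨h1, ⟨h2, h2'⟩, h3, h4, h5, h6⟩ hlt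
    simp only [Test.Holds, NatExp.eval_var, h1 14 (by omega) (by omega), hc] at hlt
    have hval : m₁.aut (m₁.nat 13) = m.aut (m₁.nat 13) := h5 _ (.inr le_rfl)
    set s := m₁.nat 13 with hs
    set j := m₁.nat 15 with hj
    refine .cons (.ite (fun hb => .skip ?_) (fun hb => ?_)) <;>
      simp only [Test.Holds, AutExp.eval, NatExp.eval_var, ← hs, hval] at hb
    · refine .cons (.assign (.nil ?_))
      simp only [NatExp.eval, NatExp.eval_var, ← hs, Function.update_self]
      refine ⟨⟨fun i hi hi' => ?_, ⟨by omega, by omega⟩, ?_, ?_, fun i hi => h5 i (by omega),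
        fun g => ?_⟩, by omega⟩
      · simp [hi, h1 i hi hi']
      · simpa using h3
      · simp; omega
      · simp only [ne_eq, Nat.reduceEqDiff, not_false_eq_true, Function.update_of_ne, ← hj]
        rw [h6]
        constructor
        · rintro ⟨i, k1, k2, k3⟩
          exact ⟨i, k1, by omega, k3⟩
        · rintro ⟨i, k1, k2, k3, k4⟩
          refine ⟨i, k1, ?_, k3, k4⟩
          rcases (show i ≤ s by omega).lt_or_eq with h | rfl
          exacts [h, absurd (k3.symm.trans hb) k4]
    · refine .cons (.setAut (.cons (.assign (.nil (.cons (.assign (.nil ?_)))))))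
      simp only [NatExp.eval, AutExp.eval, NatExp.eval_var, ← hs, ← hj, Function.update_self, hval]
      refine ⟨⟨fun i hi hi' => ?_, ⟨?_, ?_⟩, ?_, ?_, fun i hi => ?_, fun g => ?_⟩, ?_⟩
      · simp [hi, hi', h1 i hi hi']
      · simp [← hs]; omega
      · simp [← hs]; omega
      · simp; omega
      · simp [← hs]; omega
      · simp [← hs] at hi
        rw [Function.update_of_ne (by omega)]
        exact h5 i (by omega)
      · simp only [ne_eq, Nat.reduceEqDiff, not_false_eq_true, Function.update_of_ne,
          Function.update_self, ← hs]
        constructor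
        · rintro ⟨i, k1, k2, k3⟩
          by_cases hij : i = j
          · subst hij
            rw [Function.update_self] at k3
            exact ⟨s, h2, by omega, k3, k3 ▸ hb⟩
          · rw [Function.update_of_ne hij] at k3
            obtain ⟨i', k4, k5, k6⟩ := (h6 g).1 ⟨i, k1, by omega, k3⟩
            exact ⟨i', k4, by omega, k6⟩
        · rintro ⟨i, k1, k2, k3, k4⟩
          rcases (show i ≤ s by omega).lt_or_eq with h | rfl
          · obtain ⟨i', k5, k6, k7⟩ := (h6 g).2 ⟨i, k1, h, k3, k4⟩
            exact ⟨i', k5, by omega, by rwa [Function.update_of_ne (by omega)]⟩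
          · exact ⟨j, h3, by omega, by rwa [Function.update_self]⟩
      · simp [← hs]; omega
  · intro g
    rw [ht, hk]
    constructor <;> rintro ⟨i, h1, h2, -⟩ <;> omega
  · rintro m₁ ⟨⟨h1, h2, h3, h4, h5, h6⟩, h7⟩
    simp only [Test.Holds, NatExp.eval_var, h1 14 (by omega) (by omega), hc] at h7
    obtain rfl : m₁.nat 13 = c := by omega
    exact ⟨h1, rfl, h3, h4, h5, h6⟩

/-! ### Comparison of two segments -/

/-- Set register `24` to `0` unless every member of the segment of length `21` that starts at
address `20` is, up to inversion, a member of the segment of length `23` that starts at address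
`22`. -/
def compareLoop : Program :=
  .block [
    .assign 13 (.const 0),
    .assign 14 (.const 0),
    .loop (.and (.natLT (.var 13) (.var 21)) (.natLT (.var 14) (.var 23)))
      (.ite (.or
          (.autEq (.reg (.add (.var 20) (.var 13))) (.reg (.add (.var 22) (.var 14))))
          (.autEq (.reg (.add (.var 20) (.var 13))) (.inv (.reg (.add (.var 22) (.var 14))))))
        (.block [.assign 13 (.add (.var 13) (.const 1)), .assign 14 (.const 0)])
        (.assign 14 (.add (.var 14) (.const 1)))),
    .ite (.natLT (.var 13) (.var 21)) (.assign 24 (.const 0)) .skip]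

/-- The flag is only ever lowered, so running the comparison in both directions computes a
conjunction. -/
theorem runs_compareLoop {m : Memory T} {Q : Memory T → Prop} {p n q l : ℕ} (hp : m.nat 20 = p)
    (hn : m.nat 21 = n) (hq : m.nat 22 = q) (hl : m.nat 23 = l)
    (h : ∀ m', (∀ i, i ≠ 13 → i ≠ 14 → i ≠ 24 → m'.nat i = m.nat i) → m'.aut = m.aut →
      ((∀ i < n, ∃ j < l, m.aut (p + i) = m.aut (q + j) ∨ m.aut (p + i) = (m.aut (q + j))⁻¹) →
        m'.nat 24 = m.nat 24) →
      (¬ (∀ i < n, ∃ j < l,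
          m.aut (p + i) = m.aut (q + j) ∨ m.aut (p + i) = (m.aut (q + j))⁻¹) →
        m'.nat 24 = 0) → Q m') :
    Runs R compareLoop m Q := by
  set M : ℕ → ℕ → Prop := fun i j =>
    m.aut (p + i) = m.aut (q + j) ∨ m.aut (p + i) = (m.aut (q + j))⁻¹ with hM
  change ∀ m', _ → _ → ((∀ i < n, ∃ j < l, M i j) → _) → (¬ (∀ i < n, ∃ j < l, M i j) → _) → _ at h
  -- A match advances the outer index and resets the inner one, which calls for a lexicographic
  -- variant.
  have hwf : WellFounded (Prod.Lex ((· < ·) : ℕ → ℕ → Prop) ((· < ·) : ℕ → ℕ → Prop)) :=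
    WellFounded.prod_lex Nat.lt_wfRel.wf Nat.lt_wfRel.wf
  refine .cons (.assign (.cons (.assign (.cons ((Runs.loop hwf
    (fun m' => (n - m'.nat 13, l - m'.nat 14))
    (fun m' => (∀ i, i ≠ 13 → i ≠ 14 → m'.nat i = m.nat i) ∧ m'.aut = m.aut ∧
      (∀ i < m'.nat 13, ∃ j < l, M i j) ∧ ∀ j < m'.nat 14, ¬ M (m'.nat 13) j) ?_ ?_).mono ?_)))))
  · rintro m₁ ⟨h1, h2, h3, h4⟩ hlt
    simp only [Test.Holds, NatExp.eval_var, h1 21 (by omega) (by omega),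
      h1 23 (by omega) (by omega), hn, hl] at hlt
    refine .ite (fun hb => ?_) (fun hb => ?_) <;>
      simp only [Test.holds_or, Test.Holds, AutExp.eval, NatExp.eval, NatExp.eval_var,
        h1 20 (by omega) (by omega), h1 22 (by omega) (by omega), hp, hq, h2] at hb
    · refine .cons (.assign (.cons (.assign (.nil ⟨⟨fun i hi hi' => ?_, h2, ?_, ?_⟩, ?_⟩))))
      · simp [hi, hi', h1 i hi hi']
      · intro i hi
        simp [NatExp.eval] at hi
        rcases (show i ≤ m₁.nat 13 by omega).lt_or_eq with h | rfl
        exacts [h3 i h, ⟨_, hlt.2, hb⟩]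
      · simp [NatExp.eval]
      · refine .left _ _ ?_
        simp [NatExp.eval]
        omega
    · refine .assign ⟨⟨fun i hi hi' => ?_, h2, ?_, ?_⟩, ?_⟩
      · simp [hi', h1 i hi hi']
      · simpa using h3
      · intro j hj
        simp [NatExp.eval] at hj ⊢
        rcases (show j ≤ m₁.nat 14 by omega).lt_or_eq with h | rfl
        exacts [h4 j h, hb]
      · rw [Prod.lex_def]
        refine .inr ⟨by simp, ?_⟩
        simp [NatExp.eval]
        omega
  · refine ⟨fun i hi hi' => by simp [hi, hi'], rfl, ?_, ?_⟩ <;> simp [NatExp.eval]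
  · rintro m₁ ⟨⟨h1, h2, h3, h4⟩, h5⟩
    simp only [Test.Holds, NatExp.eval_var, h1 21 (by omega) (by omega),
      h1 23 (by omega) (by omega), hn, hl] at h5
    refine .cons (.ite (fun hb => .assign (.nil ?_)) (fun hb => .skip (.nil ?_))) <;>
      simp only [Test.Holds, NatExp.eval_var, h1 21 (by omega) (by omega), hn] at hb
    · refine h _ (fun i hi hi' hi'' => by simp [hi'', h1 i hi hi']) h2 (fun hall => ?_)
        (fun _ => by simp [NatExp.eval])
      obtain ⟨j, hj, hj'⟩ := hall _ hb
      exact absurd hj' (h4 j (by omega))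
    · exact h m₁ (fun i hi hi' _ => h1 i hi hi') h2 (fun _ => h1 24 (by omega) (by omega))
        (fun hn => absurd (fun i hi => h3 i (by omega)) hn)

end Lists

section Algorithm

variable {V : Type*} {T : SimpleGraph V} {hT : T.IsTree} {o : V} {R : PathOrder hT o}

/-! ### The algorithm -/

/-- Reduce both input lists. -/
def reduceBoth : Program :=
  .block [
    .assign 10 (.const 0), .assign 11 (.var 0), .assign 12 (.add (.var 0) (.var 1)),
    .assign 13 (.const 0), reduceLoop,
    .assign 10 (.var 0), .assign 11 (.var 1), .assign 13 (.const 0), reduceLoop]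

/-- The scratch registers start at `a + b`, beyond both segments, so each pass leaves the other list
untouched. -/
theorem runs_reduceBoth {G H : Subgroup (T ≃g T)} {m : Memory T} {a b : ℕ}
    (ha : m.nat 0 = a) (hb : m.nat 1 = b)
    (hG : Subgroup.closure {g | ∃ k < a, m.aut k = g} = G)
    (hH : Subgroup.closure {g | ∃ k < b, m.aut (a + k) = g} = H) :
    Runs R reduceBoth m fun m' => m'.nat 0 = a ∧ m'.nat 12 = a + b ∧
      Subgroup.closure {g | ∃ k < a, m'.aut k = g} = G ∧
      Subgroup.closure {g | ∃ k < b, m'.aut (a + k) = g} = H ∧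
      (∀ i < 2 * a, ∀ j < 2 * a, ¬ ReduciblePair R m'.aut a i j) ∧
      ∀ i < 2 * b, ∀ j < 2 * b, ¬ ReduciblePair R (fun k => m'.aut (a + k)) b i j := by
  refine .cons (.assign (.cons (.assign (.cons (.assign (.cons (.assign (.cons
    ((runs_reduceLoop (G := G) (b := 0) (n := a) (c := a + b) ?_ ?_ ?_ ?_ ?_ ?_).mono ?_)))))))))
  · simp [NatExp.eval]
  · simp [NatExp.eval, ha]
  · simp [NatExp.eval, ha, hb]
  · simp [NatExp.eval]
  · omega
  · simpa using hG
  rintro m₁ ⟨h1, h2, h3, h4⟩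
  simp only [zero_add] at h3 h4
  have h0 : m₁.nat 0 = a := by rw [h1 0 (by omega)]; simp [ha]
  have h0' : m₁.nat 1 = b := by rw [h1 1 (by omega)]; simp [hb]
  have h0'' : m₁.nat 12 = a + b := by rw [h1 12 (by omega)]; simp [NatExp.eval, ha, hb]
  refine .cons (.assign (.cons (.assign (.cons (.assign (.cons
    ((runs_reduceLoop (G := H) (b := a) (n := b) (c := a + b) ?_ ?_ ?_ ?_ le_rfl ?_).mono ?_)))))))
  · simp [h0]
  · simp [h0']
  · simp [h0'']
  · simp [NatExp.eval]
  · rw [← hH]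
    congr 1
    ext g
    exact exists_congr fun k => and_congr_right fun hk => by
      rw [h2 _ (by omega) (.inr (by omega))]
  rintro m₂ ⟨k1, k2, k3, k4⟩
  have hseg : ∀ k < a, m₂.aut k = m₁.aut k := fun k hk => k2 k (by omega) (.inl hk)
  refine .nil ⟨by rw [k1 0 (by omega)]; simp [h0], by rw [k1 12 (by omega)]; simp [h0''], ?_, k3,
    fun i hi j hj => ?_, k4⟩
  · rw [← h3]
    congr 1
    ext g
    exact exists_congr fun k => and_congr_right fun hk => by rw [hseg k hk]
  · rw [reduciblePair_congr hseg hi hj]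
    exact h4 i hi j hj

/-- Remove the trivial elements from both lists. -/
def compactBoth : Program :=
  .block [
    .assign 13 (.const 0), .assign 14 (.var 0), .assign 15 (.const 0), compactLoop,
    .assign 16 (.var 15), .assign 14 (.var 12), compactLoop,
    .assign 17 (.sub (.var 15) (.var 16))]

theorem runs_compactBoth {m : Memory T} {a b : ℕ} (ha : m.nat 0 = a) (hab : m.nat 12 = a + b) :
    Runs R compactBoth m fun m' =>
      {g | ∃ i < m'.nat 16, m'.aut i = g} = {g | ∃ i < a, m.aut i = g ∧ g ≠ 1} ∧
      {g | ∃ i < m'.nat 17, m'.aut (m'.nat 16 + i) = g} =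
        {g | ∃ i < b, m.aut (a + i) = g ∧ g ≠ 1} := by
  refine .cons (.assign (.cons (.assign (.cons (.assign (.cons
    ((runs_compactLoop (t := 0) (c := a) (k := 0) ?_ ?_ ?_ le_rfl (Nat.zero_le _)).mono ?_)))))))
  · simp [NatExp.eval]
  · simp [ha]
  · simp [NatExp.eval]
  rintro m₁ ⟨h1, h2, -, h3, h4, h5⟩
  have h12 : m₁.nat 12 = a + b := by rw [h1 12 (by omega) (by omega)]; simp [hab]
  -- Neither position is reset: reading resumes at `a` and writing right after the compacted first
  -- list, so the two lists become adjacent as the output format demands.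
  refine .cons (.assign (.cons (.assign (.cons ((runs_compactLoop (t := a) (c := a + b)
    (k := m₁.nat 15) ?_ ?_ ?_ h3 (Nat.le_add_right _ _)).mono ?_)))))
  · simp [h2]
  · simp [h12]
  · simp
  rintro m₂ ⟨k1, -, k2, -, k4, k5⟩
  have k16 : m₂.nat 16 = m₁.nat 15 := by rw [k1 16 (by omega) (by omega)]; simp
  refine .cons (.assign (.nil ?_))
  simp only [NatExp.eval, NatExp.eval_var, Function.update_self, ne_eq, Nat.reduceEqDiff,
    not_false_eq_true, Function.update_of_ne, k16]
  constructor <;> ext g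
  · refine Iff.trans ?_ ((h5 g).trans ?_)
    · refine exists_congr fun i => ?_
      constructor
      · rintro ⟨hi, h⟩
        exact ⟨Nat.zero_le i, hi, by rw [← h, k4 i (.inl hi)]⟩
      · rintro ⟨-, hi, h⟩
        exact ⟨hi, by rw [← h, k4 i (.inl hi)]⟩
    · exact exists_congr fun i => by simp
  · refine Iff.trans ?_ ((k5 g).trans ?_)
    · constructor
      · rintro ⟨i, hi, h⟩
        exact ⟨m₁.nat 15 + i, by omega, by omega, h⟩
      · rintro ⟨i, hi, hi', h⟩
        exact ⟨i - m₁.nat 15, by omega, by rwa [Nat.add_sub_cancel' hi]⟩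
    · constructor
      · rintro ⟨i, hi, hi', h, hg⟩
        refine ⟨i - a, by omega, ?_, hg⟩
        rw [Nat.add_sub_cancel' hi, ← h4 i (.inr hi)]
        exact h
      · rintro ⟨i, hi, h, hg⟩
        refine ⟨a + i, by omega, by omega, ?_, hg⟩
        rw [← h, ← h4 (a + i) (.inr (by omega))]

/-- Compare the two lists and store the output. -/
def compareBoth : Program :=
  .block [
    .assign 20 (.const 0), .assign 21 (.var 16), .assign 22 (.var 16), .assign 23 (.var 17),
    .assign 24 (.const 1), compareLoop,
    .assign 20 (.var 16), .assign 21 (.var 17), .assign 22 (.const 0), .assign 23 (.var 16),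
    compareLoop,
    .assign 0 (.var 24), .assign 1 (.var 16), .assign 2 (.var 17)]

theorem symmetrize_eq_iff {A : Type*} [Group A] {S S' : Set A} :
    symmetrize S = symmetrize S' ↔ S ⊆ symmetrize S' ∧ S' ⊆ symmetrize S := by
  constructor
  · intro h
    exact ⟨fun x hx => h ▸ .inl hx, fun x hx => h ▸ .inl hx⟩
  · rintro ⟨h, h'⟩
    apply Set.Subset.antisymm
    · rintro x (hx | hx)
      exacts [h hx, inv_inv x ▸ inv_mem_symmetrize (h hx)]
    · rintro x (hx | hx)
      exacts [h' hx, inv_inv x ▸ inv_mem_symmetrize (h' hx)]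

theorem range_subset_symmetrize_iff {A : Type*} [Group A] {x y : ℕ → A} {n l : ℕ} :
    {g | ∃ i < n, x i = g} ⊆ symmetrize {g | ∃ i < l, y i = g} ↔
      ∀ i < n, ∃ j < l, x i = y j ∨ x i = (y j)⁻¹ := by
  constructor
  · intro h i hi
    rcases h ⟨i, hi, rfl⟩ with ⟨j, hj, h⟩ | ⟨j, hj, h⟩
    · exact ⟨j, hj, .inl h.symm⟩
    · exact ⟨j, hj, .inr (by rw [h, inv_inv])⟩
  · rintro h _ ⟨i, hi, rfl⟩
    obtain ⟨j, hj, h | h⟩ := h i hi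
    · exact .inl ⟨j, hj, h.symm⟩
    · exact .inr ⟨j, hj, by rw [h, inv_inv]⟩

open Classical in
theorem runs_compareBoth (m : Memory T) :
    Runs R compareBoth m fun m' => m'.aut = m.aut ∧ m'.nat 1 = m.nat 16 ∧
      m'.nat 2 = m.nat 17 ∧ m'.nat 0 = (decide (symmetrize {g | ∃ i < m.nat 16, m.aut i = g} =
        symmetrize {g | ∃ i < m.nat 17, m.aut (m.nat 16 + i) = g})).toNat := by
  set n := m.nat 16 with hn
  set l := m.nat 17 with hl
  have hiff := symmetrize_eq_iff (S := {g | ∃ i < n, m.aut i = g})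
    (S' := {g | ∃ i < l, m.aut (n + i) = g})
  rw [range_subset_symmetrize_iff (x := m.aut), range_subset_symmetrize_iff (y := m.aut)] at hiff
  refine .cons (.assign (.cons (.assign (.cons (.assign (.cons (.assign (.cons (.assign (.cons
    (runs_compareLoop (p := 0) (n := n) (q := n) (l := l) ?_ ?_ ?_ ?_ ?_)))))))))))
  · simp [NatExp.eval]
  · simp [hn]
  · simp [hn]
  · simp [hl]
  intro m₁ h1 h2 h3 h4
  have h16 : m₁.nat 16 = n := by rw [h1 16 (by omega) (by omega) (by omega)]; simp [hn]
  have h17 : m₁.nat 17 = l := by rw [h1 17 (by omega) (by omega) (by omega)]; simp [hl]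
  simp only [Function.update_self, NatExp.eval, zero_add] at h2 h3 h4
  refine .cons (.assign (.cons (.assign (.cons (.assign (.cons (.assign (.cons
    (runs_compareLoop (p := n) (n := l) (q := 0) (l := n) ?_ ?_ ?_ ?_ ?_)))))))))
  · simp [h16]
  · simp [h17]
  · simp [NatExp.eval]
  · simp [h16]
  intro m₂ k1 k2 k3 k4
  have k16 : m₂.nat 16 = n := by rw [k1 16 (by omega) (by omega) (by omega)]; simp [h16]
  have k17 : m₂.nat 17 = l := by rw [k1 17 (by omega) (by omega) (by omega)]; simp [h17]
  simp only [zero_add, h2, ne_eq, Nat.reduceEqDiff, not_false_eq_true,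
    Function.update_of_ne] at k2 k3 k4
  refine .cons (.assign (.cons (.assign (.cons (.assign (.nil ⟨k2, ?_, ?_, ?_⟩))))))
  · simp [k16]
  · simp [k17]
  · simp only [NatExp.eval_var, ne_eq, Nat.reduceEqDiff, not_false_eq_true, Function.update_of_ne,
      Function.update_self, OfNat.zero_ne_ofNat, zero_ne_one]
    by_cases hX : ∀ i < n, ∃ j < l, m.aut i = m.aut (n + j) ∨ m.aut i = (m.aut (n + j))⁻¹ <;>
      by_cases hY : ∀ i < l, ∃ j < n, m.aut (n + i) = m.aut j ∨ m.aut (n + i) = (m.aut j)⁻¹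
    · rw [k3 hY, h3 hX, decide_eq_true (hiff.2 ⟨hX, hY⟩)]; rfl
    · rw [k4 hY, decide_eq_false (fun h => hY (hiff.1 h).2)]; rfl
    · rw [k3 hY, h4 hX, decide_eq_false (fun h => hX (hiff.1 h).1)]; rfl
    · rw [k4 hY, decide_eq_false (fun h => hY (hiff.1 h).2)]; rfl

theorem stronglyNReduced_of_not_reduciblePair {G : Subgroup (T ≃g T)} (hG : PurelyHyperbolic G)
    {x : ℕ → T ≃g T} {n : ℕ} (hx : Subgroup.closure {g | ∃ k < n, x k = g} = G)
    (h : ∀ i < 2 * n, ∀ j < 2 * n, ¬ ReduciblePair R x n i j) :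
    StronglyNReduced R {g | ∃ k < n, x k = g ∧ g ≠ 1} G := by
  have hmem : ∀ i < n, x i ∈ G := fun i hi => hx ▸ Subgroup.subset_closure ⟨i, hi, rfl⟩
  have h' : ∀ i < 2 * n, ∀ j < 2 * n, letterIndex n i ≠ letterIndex n j →
      ¬ Reducible R (letter x n i) (letter x n j) := fun i hi j hj hij hr => h i hi j hj ⟨hij, hr⟩
  have hc : Subgroup.closure {g | ∃ k < n, x k = g ∧ g ≠ 1} = G := by
    rw [← hx, ← Subgroup.closure_sdiff_one {g | ∃ k < n, x k = g}]
    congr 1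
    ext g
    constructor
    · rintro ⟨k, hk, h, h1⟩
      exact ⟨⟨k, hk, h⟩, h1⟩
    · rintro ⟨⟨k, hk, h⟩, h1⟩
      exact ⟨k, hk, h, h1⟩
  exact hc ▸ (cancelReduced_of_not_reducible hG hmem h').stronglyNReduced
    (inv_notMem_of_not_reducible hG hmem h')

/-- For equal groups, both symmetrized bases are given by the same intrinsic description in
`symmetrize_eq`. -/
theorem StronglyNReduced.eq_iff {S S' : Set (T ≃g T)} {G H : Subgroup (T ≃g T)}
    (hG : PurelyHyperbolic G) (hH : PurelyHyperbolic H) (hS : StronglyNReduced R S G)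
    (hS' : StronglyNReduced R S' H) : symmetrize S = symmetrize S' ↔ G = H := by
  constructor
  · intro h
    rw [symmetrize_eq_iff] at h
    rw [← hS.freeBasis.2, ← hS'.freeBasis.2]
    apply le_antisymm <;> rw [Subgroup.closure_le]
    exacts [fun x hx => symmetrize_subset_closure (h.1 hx),
      fun x hx => symmetrize_subset_closure (h.2 hx)]
  · rintro rfl
    rw [(hS.cancelReduced hG).symmetrize_eq, (hS'.cancelReduced hG).symmetrize_eq,
      hS.freeBasis.2, hS'.freeBasis.2]

end Algorithm

end TreeAut

theorem mainTheorem7 :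
    ∃ P : TreeAut.Program, ∀ (V : Type*) (T : SimpleGraph V) (hT : T.IsTree) (o : V)
      (R : TreeAut.PathOrder hT o) (X Y : List (T ≃g T)) (G H : Subgroup (T ≃g T)),
      G = Subgroup.closure {g | g ∈ X} → H = Subgroup.closure {g | g ∈ Y} →
      TreeAut.PurelyHyperbolic G → TreeAut.PurelyHyperbolic H →
      ∃ (m : TreeAut.Memory T) (b : Bool) (X' Y' : List (T ≃g T)),
        TreeAut.Exec R P (TreeAut.input o X Y) m ∧
        TreeAut.Output m b X' Y' ∧
        TreeAut.StronglyNReduced R {g | g ∈ X'} G ∧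
        TreeAut.StronglyNReduced R {g | g ∈ Y'} H ∧
        (b = true ↔ TreeAut.symmetrize {g | g ∈ X'} = TreeAut.symmetrize {g | g ∈ Y'}) ∧
        (b = true ↔ G = H) := by
  classical
  refine ⟨.block [TreeAut.reduceBoth, TreeAut.compactBoth, TreeAut.compareBoth],
    fun V T hT o R X Y G H hX hY hG hH => ?_⟩
  have hXs : {g | ∃ k < X.length, (TreeAut.input o X Y).aut k = g} = {g | g ∈ X} := by
    ext g
    simp only [TreeAut.input, Set.mem_ofPred_eq, List.mem_iff_getElem]
    constructor
    · rintro ⟨k, hk, rfl⟩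
      exact ⟨k, hk, by rw [List.getD_append _ _ _ _ hk, List.getD_eq_getElem _ _ hk]⟩
    · rintro ⟨k, hk, rfl⟩
      exact ⟨k, hk, by rw [List.getD_append _ _ _ _ hk, List.getD_eq_getElem _ _ hk]⟩
  have hYs : {g | ∃ k < Y.length, (TreeAut.input o X Y).aut (X.length + k) = g} =
      {g | g ∈ Y} := by
    have hget : ∀ k (hk : k < Y.length), (X ++ Y).getD (X.length + k) 1 = Y[k] := fun k hk => by
      rw [List.getD_append_right _ _ _ _ (Nat.le_add_right _ _), Nat.add_sub_cancel_left,
        List.getD_eq_getElem _ _ hk]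
    ext g
    simp only [TreeAut.input, Set.mem_ofPred_eq, List.mem_iff_getElem]
    constructor
    · rintro ⟨k, hk, rfl⟩
      exact ⟨k, hk, (hget k hk).symm⟩
    · rintro ⟨k, hk, rfl⟩
      exact ⟨k, hk, hget k hk⟩
  obtain ⟨m₃, hexec, m₁, ⟨h0, h12, hG₁, hH₁, hredX, hredY⟩, m₂, ⟨hX₂, hY₂⟩, haut, hlX, hlY, hans⟩ :
      TreeAut.Runs R (.block [TreeAut.reduceBoth, TreeAut.compactBoth, TreeAut.compareBoth])
        (TreeAut.input o X Y) fun m₃ => ∃ m₁ : TreeAut.Memory T,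
        (m₁.nat 0 = X.length ∧ m₁.nat 12 = X.length + Y.length ∧
          Subgroup.closure {g | ∃ k < X.length, m₁.aut k = g} = G ∧
          Subgroup.closure {g | ∃ k < Y.length, m₁.aut (X.length + k) = g} = H ∧
          (∀ i < 2 * X.length, ∀ j < 2 * X.length,
            ¬ TreeAut.ReduciblePair R m₁.aut X.length i j) ∧
          ∀ i < 2 * Y.length, ∀ j < 2 * Y.length,
            ¬ TreeAut.ReduciblePair R (fun k => m₁.aut (X.length + k)) Y.length i j) ∧
        ∃ m₂ : TreeAut.Memory T,
        ({g | ∃ i < m₂.nat 16, m₂.aut i = g} = {g | ∃ i < X.length, m₁.aut i = g ∧ g ≠ 1} ∧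
          {g | ∃ i < m₂.nat 17, m₂.aut (m₂.nat 16 + i) = g} =
            {g | ∃ i < Y.length, m₁.aut (X.length + i) = g ∧ g ≠ 1}) ∧
        m₃.aut = m₂.aut ∧ m₃.nat 1 = m₂.nat 16 ∧ m₃.nat 2 = m₂.nat 17 ∧
        m₃.nat 0 = (decide (TreeAut.symmetrize {g | ∃ i < m₂.nat 16, m₂.aut i = g} =
          TreeAut.symmetrize {g | ∃ i < m₂.nat 17, m₂.aut (m₂.nat 16 + i) = g})).toNat :=
    .cons ((TreeAut.runs_reduceBoth (a := X.length) (b := Y.length) rfl rfl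
        (by rw [hXs, hX]) (by rw [hYs, hY])).mono fun m₁ h₁ =>
      .cons ((TreeAut.runs_compactBoth h₁.1 h₁.2.1).mono fun m₂ h₂ =>
        .cons ((TreeAut.runs_compareBoth m₂).mono fun m₃ h₃ => .nil ⟨m₁, h₁, m₂, h₂, h₃⟩)))
  have hSX := TreeAut.stronglyNReduced_of_not_reduciblePair hG hG₁ hredX
  have hSY := TreeAut.stronglyNReduced_of_not_reduciblePair hH hH₁ hredY
  rw [← hX₂] at hSX
  rw [← hY₂] at hSY
  have hX' : {g | g ∈ (List.range (m₂.nat 16)).map m₂.aut} =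
      {g | ∃ i < m₂.nat 16, m₂.aut i = g} := by
    ext g; simp
  have hY' : {g | g ∈ (List.range (m₂.nat 17)).map fun i => m₂.aut (m₂.nat 16 + i)} =
      {g | ∃ i < m₂.nat 17, m₂.aut (m₂.nat 16 + i) = g} := by
    ext g; simp
  -- The output lists are read off the compacted registers, which the comparison did not alter.
  refine ⟨m₃, _, (List.range (m₂.nat 16)).map m₂.aut,
    (List.range (m₂.nat 17)).map fun i => m₂.aut (m₂.nat 16 + i), hexec,
    ⟨hans, by simp [hlX], by simp [hlY], fun i hi => ?_⟩, ?_⟩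
  · simp only [List.length_append, List.length_map, List.length_range] at hi
    rw [haut]
    by_cases hi' : i < m₂.nat 16
    · rw [List.getElem?_append_left (by simpa using hi')]
      simp [hi']
    · rw [List.getElem?_append_right (by simpa using hi')]
      simp only [List.length_map, List.length_range, List.getElem?_map,
        List.getElem?_range (show i - m₂.nat 16 < m₂.nat 17 by omega), Option.map_some]
      rw [Nat.add_sub_cancel' (by omega)]
  · rw [hX', hY', decide_eq_true_iff]
    exact ⟨hSX, hSY, Iff.rfl, hSX.eq_iff hG hH hSY⟩
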